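/- Let $A$ be a (finite dimensional) $C^*$-weak Hopf algebra, i.e. a finite dimensional $C^*$-algebra over $\mathbb C$ with a coassociative counital coalgebra structure $(\Delta,\varepsilon)$ and a linear map $S\colon A\to A$ (the antipode) such that, in Sweedler notation and for all $x,y,z\in A$, $$\Delta(xy)=\Delta(x)\Delta(y),\qquad \Delta(x^*)=\Delta(x)^*,$$ $$\varepsilon(xyz)=\varepsilon(xy_{(1)})\varepsilon(y_{(2)}z)=\varepsilon(xy_{(2)})\varepsilon(y_{(1)}z),$$ $$(\Delta\otimes\mathrm{id})\Delta(1)=(\Delta(1)\otimes 1)(1\otimes\Delta(1))=(1\otimes\Delta(1))(\Delta(1)\otimes 1),$$ $$x_{(1)}S(x_{(2)})=\Pi^L(x):=\varepsilon(1_{(1)}x)1_{(2)},\quad S(x_{(1)})x_{(2)}=\Pi^R(x):=1_{(1)}\varepsilon(x1_{(2)}),\quad S(x_{(1)})x_{(2)}S(x_{(3)})=S(x).$$ A Haar integral of a weak Hopf algebra is an element $h$ with $xh=\Pi^L(x)h$ and $hx=h\Pi^R(x)$ for all $x$, and $\Pi^L(h)=\Pi^R(h)=1$. Let $\hat A$ be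 the dual weak Hopf algebra of $A$, that is, the space of linear functionals on $A$ with product $(\varphi\psi)(x)=\varphi(x_{(1)})\psi(x_{(2)})$, unit $\varepsilon$, coproduct $\hat\Delta(\varphi)(x\otimes y)=\varphi(xy)$ and counit $\hat\varepsilon(\varphi)=\varphi(1)$. Then $A$ has a unique Haar integral $h$, and $\hat A$ has a unique Haar integral $\hat h$ (the Haar functional on $A$). The element $h\leftharpoonup\hat h:=\hat h(h_{(1)})h_{(2)}$ of $A$ is positive and invertible, and with $g_R:=(h\leftharpoonup\hat h)^{1/2}$ the following conditions are equivalent: 1. $S^2=\mathrm{id}_A$ (that is, $A$ is a weak Kac algebra); 2. $\hat h$ is a trace on $A$, i.e. $\hat h(xy)=\hat h(yx)$ for all $x,y\in A$; 3. $\varepsilon(g_R^{-2})=\dim_{\mathbb C}A$. -/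

import Mathlib

open scoped TensorProduct

noncomputable section

/-- The linear map `a ⊗ b ↦ φ a • b`. -/
def applyFst {k A : Type*} [Field k] [Ring A] [Algebra k A] (φ : Module.Dual k A) :
    A ⊗[k] A →ₗ[k] A :=
  TensorProduct.lift ((LinearMap.lsmul k A).comp φ)

/-- The linear map `a ⊗ b ↦ φ b • a`. -/
def applySnd {k A : Type*} [Field k] [Ring A] [Algebra k A] (φ : Module.Dual k A) :
    A ⊗[k] A →ₗ[k] A :=
  TensorProduct.lift ((LinearMap.lsmul k A).comp φ).flip

/-- The linear form `a ⊗ b ↦ φ a * ψ b`. -/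
def dualTensor {k A : Type*} [Field k] [Ring A] [Algebra k A] (φ ψ : Module.Dual k A) :
    Module.Dual k (A ⊗[k] A) :=
  (LinearMap.mul' k k).comp (TensorProduct.map φ ψ)

/-- A weak Hopf algebra over a field `k` (Böhm–Nill–Szlachányi). In Sweedler notation:
* `Δ(xy) = Δ(x)Δ(y)`;
* `ε(xyz) = ε(x y₍₁₎) ε(y₍₂₎ z) = ε(x y₍₂₎) ε(y₍₁₎ z)`;
* `(Δ ⊗ id)Δ(1) = (Δ(1) ⊗ 1)(1 ⊗ Δ(1)) = (1 ⊗ Δ(1))(Δ(1) ⊗ 1)`;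
* `x₍₁₎ S(x₍₂₎) = ε(1₍₁₎ x) 1₍₂₎`, `S(x₍₁₎) x₍₂₎ = 1₍₁₎ ε(x 1₍₂₎)`,
  `S(x₍₁₎) x₍₂₎ S(x₍₃₎) = S(x)`.
Neither `Δ(1) = 1 ⊗ 1` nor multiplicativity of `ε` is required. -/
class WeakHopfAlgebra (k A : Type*) [Field k] [Ring A] [Algebra k A] extends
    Coalgebra k A where
  comul_mul (x y : A) : comul (x * y) = comul x * comul y
  counit_mul_mul (x y z : A) : counit (x * y * z) =
    dualTensor (counit.comp (LinearMap.mulLeft k x)) (counit.comp (LinearMap.mulRight k z))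
      (comul y)
  counit_mul_mul' (x y z : A) : counit (x * y * z) =
    dualTensor (counit.comp (LinearMap.mulRight k z)) (counit.comp (LinearMap.mulLeft k x))
      (comul y)
  comul_comul_one : TensorProduct.map comul LinearMap.id (comul 1) =
    (comul 1 ⊗ₜ[k] 1) * (TensorProduct.assoc k A A A).symm (1 ⊗ₜ[k] comul 1)
  comul_comul_one' : TensorProduct.map comul LinearMap.id (comul 1) =
    (TensorProduct.assoc k A A A).symm (1 ⊗ₜ[k] comul 1) * (comul 1 ⊗ₜ[k] 1)
  /-- The antipode `S`. -/
  antipode : A →ₗ[k] A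
  mul_antipode (x : A) : LinearMap.mul' k A (TensorProduct.map LinearMap.id antipode (comul x)) =
    applyFst (counit.comp (LinearMap.mulRight k x)) (comul 1)
  antipode_mul (x : A) : LinearMap.mul' k A (TensorProduct.map antipode LinearMap.id (comul x)) =
    applySnd (counit.comp (LinearMap.mulLeft k x)) (comul 1)
  antipode_mul_antipode (x : A) :
    LinearMap.mul' k A (TensorProduct.map
      ((LinearMap.mul' k A).comp (TensorProduct.map antipode LinearMap.id)) antipode
      (TensorProduct.map comul LinearMap.id (comul x))) = antipode x

/-- A (finite dimensional) C⋆-algebra with a weak Hopf algebra structure whose coproduct is a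
⋆-homomorphism, `Δ(x⋆) = Δ(x)⋆` with `(a ⊗ b)⋆ = a⋆ ⊗ b⋆`. Finite dimensionality is a separate
hypothesis `[FiniteDimensional ℂ A]`. -/
class CStarWeakHopfAlgebra (A : Type*) [CStarAlgebra A] extends WeakHopfAlgebra ℂ A where
  comul_star (x : A) : comul (star x) = star (comul x)

namespace WeakHopfAlgebra

open Coalgebra

variable {k A : Type*} [Field k] [Ring A] [Algebra k A] [WeakHopfAlgebra k A]

variable (k) in
/-- `Π^L(x) = ε(1₍₁₎ x) 1₍₂₎`. -/
def piL (x : A) : A :=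
  applyFst (counit.comp (LinearMap.mulRight k x)) (comul (R := k) 1)

variable (k) in
/-- `Π^R(x) = 1₍₁₎ ε(x 1₍₂₎)`. -/
def piR (x : A) : A :=
  applySnd (counit.comp (LinearMap.mulLeft k x)) (comul (R := k) 1)

variable (k) in
/-- A Haar integral of `A`: a two-sided integral (`x h = Π^L(x) h` and `h x = h Π^R(x)` for all
`x`) which is normalized (`Π^L(h) = 1 = Π^R(h)`). -/
structure IsHaarIntegral (h : A) : Prop where
  left_integral : ∀ x : A, x * h = piL k x * h
  right_integral : ∀ x : A, h * x = h * piR k x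
  left_normalized : piL k h = 1
  right_normalized : piR k h = 1

/-! The operations of the dual weak Hopf algebra `Â = Hom(A, k)`: its product is
`(φψ)(x) = φ(x₍₁₎) ψ(x₍₂₎)`, its unit is `1̂ = ε`, its coproduct is `Δ̂(φ)(x ⊗ y) = φ(xy)` and
its counit is `ε̂(φ) = φ(1)`. -/

/-- The product of `Â`. -/
def dualMul (φ ψ : Module.Dual k A) : Module.Dual k A :=
  (dualTensor φ ψ).comp comul

/-- `Π̂^L(φ) = ε̂(1̂₍₁₎ φ) 1̂₍₂₎` in `Â`. Since `1̂₍₁₎(y) 1̂₍₂₎(x) = ε(yx)`, its value at `x` is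
the value at `1` of the product of `ε(· x)` and `φ`. -/
def dualPiL (φ : Module.Dual k A) : Module.Dual k A where
  toFun x := dualMul (counit.comp (LinearMap.mulRight k x)) φ 1
  map_add' x y := by
    have e : LinearMap.mulRight k (x + y) = LinearMap.mulRight k x + LinearMap.mulRight k y := by
      ext z; simp [mul_add]
    simp [dualMul, dualTensor, e, LinearMap.comp_add, TensorProduct.map_add_left]
  map_smul' c x := by
    have e : LinearMap.mulRight k (c • x) = c • LinearMap.mulRight k x := by
      ext z; simp
    simp [dualMul, dualTensor, e, LinearMap.comp_smul, TensorProduct.map_smul_left]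

/-- `Π̂^R(φ) = 1̂₍₁₎ ε̂(φ 1̂₍₂₎)` in `Â`. Since `1̂₍₁₎(x) 1̂₍₂₎(y) = ε(xy)`, its value at `x` is
the value at `1` of the product of `φ` and `ε(x ·)`. -/
def dualPiR (φ : Module.Dual k A) : Module.Dual k A where
  toFun x := dualMul φ (counit.comp (LinearMap.mulLeft k x)) 1
  map_add' x y := by
    have e : LinearMap.mulLeft k (x + y) = LinearMap.mulLeft k x + LinearMap.mulLeft k y := by
      ext z; simp [add_mul]
    simp [dualMul, dualTensor, e, LinearMap.comp_add, TensorProduct.map_add_right]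
  map_smul' c x := by
    have e : LinearMap.mulLeft k (c • x) = c • LinearMap.mulLeft k x := by
      ext z; simp
    simp [dualMul, dualTensor, e, LinearMap.comp_smul, TensorProduct.map_smul_right]

/-- A Haar functional on `A`: a Haar integral of the dual weak Hopf algebra `Â`, i.e. a normalized
two-sided integral of `Â`, regarded as a linear functional on `A`. -/
structure IsHaarFunctional (η : Module.Dual k A) : Prop where
  left_integral : ∀ φ : Module.Dual k A, dualMul φ η = dualMul (dualPiL φ) η
  right_integral : ∀ φ : Module.Dual k A, dualMul η φ = dualMul η (dualPiR φ)
  left_normalized : dualPiL η = counit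
  right_normalized : dualPiR η = counit

/-- The right action `x ↼ φ = φ(x₍₁₎) x₍₂₎` of `Â` on `A`. -/
def hitRight (x : A) (φ : Module.Dual k A) : A :=
  applyFst φ (comul x)

end WeakHopfAlgebra

/-- The element `g_R = (h ↼ ĥ)^{1/2}` built from the Haar integral `h` and the Haar functional
`ĥ`; it is the `A^R`-factor of the canonical grouplike element `g = g_L g_R⁻¹`, where
`g_L = (ĥ ⇀ h)^{1/2}`. -/
def grouplikeR {A : Type*} [CStarAlgebra A] [PartialOrder A] [StarOrderedRing A]
    [CStarWeakHopfAlgebra A] (h : A) (η : Module.Dual ℂ A) : A :=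
  CFC.sqrt (WeakHopfAlgebra.hitRight h η)

end

/-! One positive invertible element controls all three conditions. Let tr be the trace of the left
regular representation, a faithful positive trace, let h be the Haar integral and d = S(h₍₁₎)
tr(h₍₂₎). The tensor c = S(h₍₁₎) ⊗ h₍₂₎ satisfies (y ⊗ 1)c = c(1 ⊗ y) and multiplies to 1; since
S(h) = h, it equals its own flip up to S² on the first leg. Hence d is invertible and x d = d S²(x)
(`IsTraceFrame.mul_density'`), so d = 1 forces S² = id. Conversely d = h₍₂₎ S(h₍₁₎)
(`IsTraceFrame.density_eq_mul'_comm`); if S² = id then c is symmetric and d = S(h₍₁₎) h₍₂₎ = 1.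

The functional λ = tr(d⁻¹ ·) is dual to h: λ(x S(h₍₁₎)) h₍₂₎ = x. It is invariant but not
normalized. Let z in A^R represent the counit, λ(yz) = ε(y) on A^R; then η = λ(· z) is the Haar
functional and h ↼ η = z (`IsCounitDensity.hitRight_eq`), so g_R² = z. Positivity of z comes from
λ(y⋆ z y) = λ((hy)⋆(hy)) for y in A^R.

Condition 3: ε(z⁻¹) = λ(z⁻¹ z) = tr(d⁻¹), while tr(d) = tr(1) = dim A. So tr((d^{1/2} − d^{-1/2})²)
= tr(d⁻¹) − dim A, which vanishes exactly when d = 1.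

Condition 2: η(u₍₁₎ v) u₍₂₎ = S(η(u v₍₁₎) v₍₂₎), and for tracial η using this twice yields S² = id.
If S² = id, then d = 1 and z is central, so η = tr(· z) is a trace.

Existence of h uses the same inner product tr(x⋆ y): h is the component of 1 orthogonal to the left
ideal of all x with ε(ax) = 0 for every a. -/

noncomputable section

namespace WeakHopfAlgebra

open Coalgebra TensorProduct

/-! ### Convolution of linear maps on a coalgebra -/

section Convolution

variable {k C B B' : Type*} [Field k] [AddCommGroup C] [Module k C] [Coalgebra k C]
  [Ring B] [Algebra k B] [Ring B'] [Algebra k B']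

/-- The convolution `x ↦ f x₍₁₎ * g x₍₂₎`. -/
def conv (f g : C →ₗ[k] B) : C →ₗ[k] B :=
  LinearMap.mul' k B ∘ₗ TensorProduct.map f g ∘ₗ comul

theorem conv_apply (f g : C →ₗ[k] B) (x : C) :
    conv f g x = LinearMap.mul' k B (TensorProduct.map f g (comul x)) := rfl

theorem conv_repr (f g : C →ₗ[k] B) {x : C} {ι : Type*} (r : Coalgebra.Repr k x ι) :
    conv f g x = ∑ i ∈ r.index, f (r.left i) * g (r.right i) := by
  simp [conv_apply, ← r.eq]

theorem conv_assoc (f g h : C →ₗ[k] B) : conv (conv f g) h = conv f (conv g h) :=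
  congrArg WithConv.ofConv
    (mul_assoc (WithConv.toConv f) (WithConv.toConv g) (WithConv.toConv h))

theorem mulLeft_comp_conv (c : B) (f g : C →ₗ[k] B) :
    conv (LinearMap.mulLeft k c ∘ₗ f) g = LinearMap.mulLeft k c ∘ₗ conv f g := by
  ext x
  simp [conv_repr _ _ (ℛ k x), mul_assoc]

theorem algHom_comp_conv (φ : B →ₐ[k] B') (f g : C →ₗ[k] B) :
    φ.toLinearMap ∘ₗ conv f g = conv (φ.toLinearMap ∘ₗ f) (φ.toLinearMap ∘ₗ g) := by
  ext x
  simp [conv_repr _ _ (ℛ k x)]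

end Convolution

/-! ### Slicing tensors by functionals -/

variable {k A : Type*} [Field k] [Ring A] [Algebra k A]

@[simp] theorem applyFst_tmul (φ : Module.Dual k A) (a b : A) :
    applyFst φ (a ⊗ₜ[k] b) = φ a • b := by simp [applyFst]

@[simp] theorem applySnd_tmul (φ : Module.Dual k A) (a b : A) :
    applySnd φ (a ⊗ₜ[k] b) = φ b • a := by simp [applySnd]

@[simp] theorem dualTensor_tmul (φ ψ : Module.Dual k A) (a b : A) :
    dualTensor φ ψ (a ⊗ₜ[k] b) = φ a * ψ b := by simp [dualTensor]

theorem apply_applyFst (φ ψ : Module.Dual k A) (t : A ⊗[k] A) :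
    ψ (applyFst φ t) = dualTensor φ ψ t := by
  induction t using TensorProduct.induction_on with
  | zero => simp
  | tmul a b => simp
  | add s t hs ht => simp [hs, ht]

theorem apply_applySnd (φ ψ : Module.Dual k A) (t : A ⊗[k] A) :
    ψ (applySnd φ t) = dualTensor ψ φ t := by
  induction t using TensorProduct.induction_on with
  | zero => simp
  | tmul a b => simp [mul_comm]
  | add s t hs ht => simp [hs, ht]

theorem applyFst_map (φ : Module.Dual k A) (f g : A →ₗ[k] A) (t : A ⊗[k] A) :
    applyFst φ (TensorProduct.map f g t) = g (applyFst (φ ∘ₗ f) t) := by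
  induction t using TensorProduct.induction_on with
  | zero => simp
  | tmul a b => simp
  | add s t hs ht => simp [hs, ht]

theorem applySnd_map (φ : Module.Dual k A) (f g : A →ₗ[k] A) (t : A ⊗[k] A) :
    applySnd φ (TensorProduct.map f g t) = f (applySnd (φ ∘ₗ g) t) := by
  induction t using TensorProduct.induction_on with
  | zero => simp
  | tmul a b => simp
  | add s t hs ht => simp [hs, ht]

theorem applyFst_mul_one_tmul (φ : Module.Dual k A) (t : A ⊗[k] A) (y : A) :
    applyFst φ (t * (1 ⊗ₜ y)) = applyFst φ t * y := by
  induction t using TensorProduct.induction_on with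
  | zero => simp
  | tmul a b => simp
  | add s t hs ht => simp [hs, ht, add_mul]

theorem applyFst_one_tmul_mul (φ : Module.Dual k A) (t : A ⊗[k] A) (y : A) :
    applyFst φ ((1 ⊗ₜ y) * t) = y * applyFst φ t := by
  induction t using TensorProduct.induction_on with
  | zero => simp
  | tmul a b => simp
  | add s t hs ht => simp [hs, ht, mul_add]

theorem applyFst_mul_tmul_one (φ : Module.Dual k A) (t : A ⊗[k] A) (y : A) :
    applyFst φ (t * (y ⊗ₜ 1)) = applyFst (φ ∘ₗ LinearMap.mulRight k y) t := by
  induction t using TensorProduct.induction_on with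
  | zero => simp
  | tmul a b => simp
  | add s t hs ht => simp [hs, ht, add_mul]

theorem applyFst_tmul_one_mul (φ : Module.Dual k A) (t : A ⊗[k] A) (y : A) :
    applyFst φ ((y ⊗ₜ 1) * t) = applyFst (φ ∘ₗ LinearMap.mulLeft k y) t := by
  induction t using TensorProduct.induction_on with
  | zero => simp
  | tmul a b => simp
  | add s t hs ht => simp [hs, ht, mul_add]

theorem applySnd_mul_tmul_one (φ : Module.Dual k A) (t : A ⊗[k] A) (y : A) :
    applySnd φ (t * (y ⊗ₜ 1)) = applySnd φ t * y := by
  induction t using TensorProduct.induction_on with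
  | zero => simp
  | tmul a b => simp
  | add s t hs ht => simp [hs, ht, add_mul]

theorem applySnd_tmul_one_mul (φ : Module.Dual k A) (t : A ⊗[k] A) (y : A) :
    applySnd φ ((y ⊗ₜ 1) * t) = y * applySnd φ t := by
  induction t using TensorProduct.induction_on with
  | zero => simp
  | tmul a b => simp
  | add s t hs ht => simp [hs, ht, mul_add]

theorem applySnd_mul_one_tmul (φ : Module.Dual k A) (t : A ⊗[k] A) (y : A) :
    applySnd φ (t * (1 ⊗ₜ y)) = applySnd (φ ∘ₗ LinearMap.mulRight k y) t := by
  induction t using TensorProduct.induction_on with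
  | zero => simp
  | tmul a b => simp
  | add s t hs ht => simp [hs, ht, add_mul]

theorem applySnd_one_tmul_mul (φ : Module.Dual k A) (t : A ⊗[k] A) (y : A) :
    applySnd φ ((1 ⊗ₜ y) * t) = applySnd (φ ∘ₗ LinearMap.mulLeft k y) t := by
  induction t using TensorProduct.induction_on with
  | zero => simp
  | tmul a b => simp
  | add s t hs ht => simp [hs, ht, mul_add]

theorem lid_rTensor (φ : Module.Dual k A) (t : A ⊗[k] A) :
    TensorProduct.lid k A (φ.rTensor A t) = applyFst φ t := by
  induction t using TensorProduct.induction_on with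
  | zero => simp
  | tmul a b => simp
  | add s t hs ht => simp [hs, ht]

theorem rid_lTensor (φ : Module.Dual k A) (t : A ⊗[k] A) :
    TensorProduct.rid k A (φ.lTensor A t) = applySnd φ t := by
  induction t using TensorProduct.induction_on with
  | zero => simp
  | tmul a b => simp
  | add s t hs ht => simp [hs, ht]

/-- Two tensors agree if all functionals on the first leg do. -/
theorem ext_applyFst {s t : A ⊗[k] A} (h : ∀ φ : Module.Dual k A, applyFst φ s = applyFst φ t) :
    s = t := by
  classical
  apply (TensorProduct.equivFinsuppOfBasisLeft (Module.Basis.ofVectorSpace k A)).injective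
  refine Finsupp.ext fun i => ?_
  simp only [TensorProduct.equivFinsuppOfBasisLeft_apply, lid_rTensor, h]

theorem applyFst_comm (φ : Module.Dual k A) (t : A ⊗[k] A) :
    applyFst φ (TensorProduct.comm k A A t) = applySnd φ t := by
  induction t using TensorProduct.induction_on with
  | zero => simp
  | tmul a b => simp
  | add s t hs ht => simp [hs, ht]

theorem applySnd_comm (φ : Module.Dual k A) (t : A ⊗[k] A) :
    applySnd φ (TensorProduct.comm k A A t) = applyFst φ t := by
  induction t using TensorProduct.induction_on with
  | zero => simp
  | tmul a b => simp
  | add s t hs ht => simp [hs, ht]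

theorem mul'_mul_one_tmul (s : A ⊗[k] A) (x : A) :
    LinearMap.mul' k A (s * (1 ⊗ₜ x)) = LinearMap.mul' k A s * x := by
  induction s using TensorProduct.induction_on with
  | zero => simp
  | tmul a b => simp [mul_assoc]
  | add s t hs ht => simp only [add_mul, map_add, hs, ht]

/-- Two tensors agree if all functionals on the second leg do. -/
theorem ext_applySnd {s t : A ⊗[k] A} (h : ∀ φ : Module.Dual k A, applySnd φ s = applySnd φ t) :
    s = t := by
  apply (TensorProduct.comm k A A).injective
  refine ext_applyFst fun φ => ?_
  rw [applyFst_comm, applyFst_comm, h]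

/-! ### Counit and counital maps -/

variable [WeakHopfAlgebra k A]

@[simp] theorem applyFst_counit_comul (x : A) : applyFst (counit (R := k)) (comul x) = x := by
  rw [← lid_rTensor, rTensor_counit_comul, TensorProduct.lid_tmul, one_smul]

@[simp] theorem applySnd_counit_comul (x : A) : applySnd (counit (R := k)) (comul x) = x := by
  rw [← rid_lTensor, lTensor_counit_comul, TensorProduct.rid_tmul, one_smul]

theorem comul_eq_one_mul (x : A) : comul (R := k) x = comul 1 * comul x := by
  rw [← comul_mul, one_mul]

theorem comul_eq_mul_one (x : A) : comul (R := k) x = comul x * comul 1 := by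
  rw [← comul_mul, mul_one]

theorem comul_one_mul_self : comul (R := k) (1 : A) * comul 1 = comul 1 := by
  rw [← comul_mul, one_mul]

variable (k A) in
/-- The antipode as a linear endomorphism, with all arguments explicit. -/
abbrev anti : A →ₗ[k] A := antipode

variable (k A) in
/-- `Π^L = id * S` as a linear map. -/
def piLHom : A →ₗ[k] A := conv LinearMap.id (anti k A)

variable (k A) in
/-- `Π^R = S * id` as a linear map. -/
def piRHom : A →ₗ[k] A := conv (anti k A) LinearMap.id

theorem piLHom_apply (x : A) : piLHom k A x = piL k x := mul_antipode x

theorem piRHom_apply (x : A) : piRHom k A x = piR k x := antipode_mul x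

theorem conv_anti_id_anti : conv (conv (anti k A) LinearMap.id) (anti k A) = anti k A := by
  ext x
  refine Eq.trans ?_ (antipode_mul_antipode (k := k) x)
  rw [conv_apply, ← LinearMap.comp_apply (TensorProduct.map _ _) (TensorProduct.map _ _),
    ← TensorProduct.map_comp]
  rfl

theorem conv_piRHom_anti : conv (piRHom k A) (anti k A) = anti k A := conv_anti_id_anti

theorem conv_anti_piLHom : conv (anti k A) (piLHom k A) = anti k A := by
  rw [piLHom, ← conv_assoc, conv_anti_id_anti]

theorem counit_mul_piL (x y : A) : counit (R := k) (x * piL k y) = counit (R := k) (x * y) := by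
  have h := counit_mul_mul' (k := k) x 1 y
  rw [mul_one] at h
  rw [h]
  exact apply_applyFst _ (counit ∘ₗ LinearMap.mulLeft k x) _

theorem counit_piR_mul (x y : A) : counit (R := k) (piR k x * y) = counit (R := k) (x * y) := by
  have h := counit_mul_mul' (k := k) x 1 y
  rw [mul_one] at h
  rw [h]
  exact apply_applySnd _ (counit ∘ₗ LinearMap.mulRight k y) _

variable (k) in
/-- `x ↦ 1₍₁₎ ε(1₍₂₎ x)`. -/
def piLBar (x : A) : A := applySnd (counit ∘ₗ LinearMap.mulRight k x) (comul (R := k) 1)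

variable (k) in
/-- `x ↦ ε(x 1₍₁₎) 1₍₂₎`. -/
def piRBar (x : A) : A := applyFst (counit ∘ₗ LinearMap.mulLeft k x) (comul (R := k) 1)

theorem counit_mul_piLBar (x y : A) :
    counit (R := k) (x * piLBar k y) = counit (R := k) (x * y) := by
  have h := counit_mul_mul (k := k) x 1 y
  rw [mul_one] at h
  rw [h]
  exact apply_applySnd _ (counit ∘ₗ LinearMap.mulLeft k x) _

theorem counit_piRBar_mul (x y : A) :
    counit (R := k) (piRBar k x * y) = counit (R := k) (x * y) := by
  have h := counit_mul_mul (k := k) x 1 y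
  rw [mul_one] at h
  rw [h]
  exact apply_applyFst _ (counit ∘ₗ LinearMap.mulRight k y) _

/-- Π^L(x) depends on x only through the functional ε(· x), so identities for Π^L can be tested
under ε. -/
theorem piL_congr {x y : A} (h : ∀ a : A, counit (R := k) (a * x) = counit (R := k) (a * y)) :
    piL k x = piL k y := by
  unfold piL; congr 2; ext a; exact h a

theorem piR_congr {x y : A} (h : ∀ a : A, counit (R := k) (x * a) = counit (R := k) (y * a)) :
    piR k x = piR k y := by
  unfold piR; congr 2; ext a; exact h a

theorem piL_mul_piL (x y : A) : piL k (x * piL k y) = piL k (x * y) :=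
  piL_congr fun a => by rw [← mul_assoc, counit_mul_piL, mul_assoc]

theorem piR_piR_mul (x y : A) : piR k (piR k x * y) = piR k (x * y) :=
  piR_congr fun a => by rw [mul_assoc, counit_piR_mul, mul_assoc]

theorem piL_piLBar (x : A) : piL k (piLBar k x) = piL k x :=
  piL_congr fun a => counit_mul_piLBar a x

theorem piR_piRBar (x : A) : piR k (piRBar k x) = piR k x :=
  piR_congr fun a => counit_piRBar_mul x a

theorem piL_one : piL k (1 : A) = 1 := by
  have : (counit (R := k) ∘ₗ LinearMap.mulRight k (1 : A)) = counit := by ext; simp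
  rw [piL, this, applyFst_counit_comul]

theorem piR_one : piR k (1 : A) = 1 := by
  have : (counit (R := k) ∘ₗ LinearMap.mulLeft k (1 : A)) = counit := by ext; simp
  rw [piR, this, applySnd_counit_comul]

/-! ### The base algebras A^L and A^R -/

variable (k A) in
/-- The left base algebra `A^L`. -/
def baseL : Subalgebra k A where
  carrier := {y | comul (R := k) y = (y ⊗ₜ 1) * comul 1 ∧ comul (R := k) y = comul 1 * (y ⊗ₜ 1)}
  mul_mem' := by
    rintro x y ⟨hx, hx'⟩ ⟨hy, hy'⟩
    have e : (x * y) ⊗ₜ[k] (1 : A) = (x ⊗ₜ 1) * (y ⊗ₜ 1) := by simp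
    constructor
    · rw [comul_mul, hx, hy', ← mul_assoc, mul_assoc _ (comul 1) (comul 1), comul_one_mul_self,
        mul_assoc, ← hy', hy, e, mul_assoc]
    · rw [comul_mul, hx, hy', ← mul_assoc, mul_assoc _ (comul 1) (comul 1), comul_one_mul_self,
        ← hx, hx', e, mul_assoc]
  add_mem' := by
    rintro x y ⟨hx, hx'⟩ ⟨hy, hy'⟩
    exact ⟨by rw [map_add, hx, hy, add_tmul, add_mul], by rw [map_add, hx', hy', add_tmul, mul_add]⟩
  algebraMap_mem' r := by
    simp [Algebra.algebraMap_eq_smul_one, ← smul_tmul', ← Algebra.TensorProduct.one_def]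

variable (k A) in
/-- The right base algebra `A^R`. -/
def baseR : Subalgebra k A where
  carrier := {y | comul (R := k) y = (1 ⊗ₜ y) * comul 1 ∧ comul (R := k) y = comul 1 * (1 ⊗ₜ y)}
  mul_mem' := by
    rintro x y ⟨hx, hx'⟩ ⟨hy, hy'⟩
    have e : (1 : A) ⊗ₜ[k] (x * y) = (1 ⊗ₜ x) * (1 ⊗ₜ y) := by simp
    constructor
    · rw [comul_mul, hx, hy', ← mul_assoc, mul_assoc _ (comul 1) (comul 1), comul_one_mul_self,
        mul_assoc, ← hy', hy, e, mul_assoc]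
    · rw [comul_mul, hx, hy', ← mul_assoc, mul_assoc _ (comul 1) (comul 1), comul_one_mul_self,
        ← hx, hx', e, mul_assoc]
  add_mem' := by
    rintro x y ⟨hx, hx'⟩ ⟨hy, hy'⟩
    exact ⟨by rw [map_add, hx, hy, tmul_add, add_mul], by rw [map_add, hx', hy', tmul_add, mul_add]⟩
  algebraMap_mem' r := by
    simp [Algebra.algebraMap_eq_smul_one, ← Algebra.TensorProduct.one_def]

theorem mem_baseL {y : A} : y ∈ baseL k A ↔
    comul (R := k) y = (y ⊗ₜ 1) * comul 1 ∧ comul (R := k) y = comul 1 * (y ⊗ₜ 1) := Iff.rfl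

theorem mem_baseR {y : A} : y ∈ baseR k A ↔
    comul (R := k) y = (1 ⊗ₜ y) * comul 1 ∧ comul (R := k) y = comul 1 * (1 ⊗ₜ y) := Iff.rfl

theorem comul_baseL_mul {y : A} (hy : y ∈ baseL k A) (x : A) :
    comul (R := k) (y * x) = (y ⊗ₜ 1) * comul x := by
  rw [comul_mul, hy.1, mul_assoc, ← comul_eq_one_mul]

theorem comul_mul_baseL {y : A} (hy : y ∈ baseL k A) (x : A) :
    comul (R := k) (x * y) = comul x * (y ⊗ₜ 1) := by
  rw [comul_mul, hy.2, ← mul_assoc, ← comul_eq_mul_one]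

theorem comul_baseR_mul {y : A} (hy : y ∈ baseR k A) (x : A) :
    comul (R := k) (y * x) = (1 ⊗ₜ y) * comul x := by
  rw [comul_mul, hy.1, mul_assoc, ← comul_eq_one_mul]

theorem comul_mul_baseR {y : A} (hy : y ∈ baseR k A) (x : A) :
    comul (R := k) (x * y) = comul x * (1 ⊗ₜ y) := by
  rw [comul_mul, hy.2, ← mul_assoc, ← comul_eq_mul_one]

theorem comul_injective : Function.Injective (comul (R := k) (A := A)) := fun x y h => by
  rw [← applyFst_counit_comul (k := k) x, h, applyFst_counit_comul]

theorem baseL_comm_baseR {x y : A} (hx : x ∈ baseL k A) (hy : y ∈ baseR k A) :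
    x * y = y * x := by
  apply comul_injective (k := k)
  rw [comul_baseL_mul hx, comul_baseR_mul hy, hx.1, hy.1, ← mul_assoc, ← mul_assoc]
  simp

theorem piL_of_mem {y : A} (hy : y ∈ baseL k A) : piL k y = y := by
  rw [piL, ← applyFst_mul_tmul_one, ← hy.2, applyFst_counit_comul]

theorem piR_of_mem {y : A} (hy : y ∈ baseR k A) : piR k y = y := by
  rw [piR, ← applySnd_one_tmul_mul, ← hy.1, applySnd_counit_comul]

theorem comul_applyFst (φ : Module.Dual k A) (x : A) :
    TensorProduct.map (applyFst φ) LinearMap.id (TensorProduct.map comul LinearMap.id (comul x)) =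
      comul (R := k) (applyFst φ (comul x)) := by
  have h := coassoc_symm_apply (R := k) x
  rw [LinearMap.rTensor] at h
  rw [← h]
  have key : ∀ (a : A) (s : A ⊗[k] A), TensorProduct.map (applyFst φ) LinearMap.id
      ((TensorProduct.assoc k A A A).symm (a ⊗ₜ s)) = φ a • s := by
    intro a s
    induction s using TensorProduct.induction_on with
    | zero => simp
    | tmul b c => simp [smul_tmul']
    | add s t hs ht => simp [tmul_add, hs, ht]
  induction comul (R := k) x using TensorProduct.induction_on with
  | zero => simp
  | tmul a b => simp [key]
  | add s t hs ht => simp [hs, ht]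

theorem comul_applySnd (φ : Module.Dual k A) (x : A) :
    TensorProduct.map LinearMap.id (applySnd φ) (TensorProduct.assoc k A A A
      (TensorProduct.map comul LinearMap.id (comul x))) =
      comul (R := k) (applySnd φ (comul x)) := by
  have key : ∀ (s : A ⊗[k] A) (c : A), TensorProduct.map LinearMap.id (applySnd φ)
      (TensorProduct.assoc k A A A (s ⊗ₜ c)) = φ c • s := by
    intro s c
    induction s using TensorProduct.induction_on with
    | zero => simp
    | tmul a b => simp
    | add s t hs ht => simp [add_tmul, hs, ht]
  induction comul (R := k) x using TensorProduct.induction_on with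
  | zero => simp
  | tmul a b => simp [key]
  | add s t hs ht => simp [hs, ht]

/-- Slice the first leg of (Δ ⊗ id)Δ(1). The two factorizations of this tensor give the two
conditions defining A^L. -/
theorem applyFst_comul_one_mem (φ : Module.Dual k A) : applyFst φ (comul 1) ∈ baseL k A := by
  rw [mem_baseL, ← comul_applyFst]
  constructor
  · rw [comul_comul_one]
    generalize comul (R := k) (1 : A) = s
    have key : ∀ s t : A ⊗[k] A, TensorProduct.map (applyFst φ) LinearMap.id
        ((s ⊗ₜ[k] 1) * (TensorProduct.assoc k A A A).symm (1 ⊗ₜ[k] t)) =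
        (applyFst φ s ⊗ₜ 1) * t := by
      intro s t
      induction s using TensorProduct.induction_on with
      | zero => simp
      | add s s' hs hs' => simp only [add_tmul, add_mul, map_add, hs, hs']
      | tmul a b =>
      induction t using TensorProduct.induction_on with
      | zero => simp
      | tmul c d => simp
      | add s t hs ht => simp only [tmul_add, mul_add, map_add, hs, ht]
    exact key s s
  · rw [comul_comul_one']
    generalize comul (R := k) (1 : A) = s
    have key : ∀ s t : A ⊗[k] A, TensorProduct.map (applyFst φ) LinearMap.id
        ((TensorProduct.assoc k A A A).symm (1 ⊗ₜ[k] t) * (s ⊗ₜ[k] 1)) =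
        t * (applyFst φ s ⊗ₜ 1) := by
      intro s t
      induction s using TensorProduct.induction_on with
      | zero => simp
      | add s s' hs hs' => simp only [add_tmul, mul_add, map_add, hs, hs']
      | tmul a b =>
      induction t using TensorProduct.induction_on with
      | zero => simp
      | tmul c d => simp
      | add s t hs ht => simp only [tmul_add, add_mul, map_add, hs, ht]
    exact key s s

theorem applySnd_comul_one_mem (φ : Module.Dual k A) : applySnd φ (comul 1) ∈ baseR k A := by
  rw [mem_baseR, ← comul_applySnd]
  constructor
  · rw [comul_comul_one']
    generalize comul (R := k) (1 : A) = s
    have key : ∀ s t : A ⊗[k] A, TensorProduct.map LinearMap.id (applySnd φ)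
        (TensorProduct.assoc k A A A
          ((TensorProduct.assoc k A A A).symm (1 ⊗ₜ[k] t) * (s ⊗ₜ[k] 1))) =
        (1 ⊗ₜ applySnd φ t) * s := by
      intro s t
      induction s using TensorProduct.induction_on with
      | zero => simp
      | add s s' hs hs' => simp only [add_tmul, mul_add, map_add, hs, hs']
      | tmul a b =>
      induction t using TensorProduct.induction_on with
      | zero => simp
      | tmul c d => simp
      | add s t hs ht => simp only [tmul_add, add_mul, map_add, hs, ht]
    exact key s s
  · rw [comul_comul_one]
    generalize comul (R := k) (1 : A) = s
    have key : ∀ s t : A ⊗[k] A, TensorProduct.map LinearMap.id (applySnd φ)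
        (TensorProduct.assoc k A A A
          ((s ⊗ₜ[k] 1) * (TensorProduct.assoc k A A A).symm (1 ⊗ₜ[k] t))) =
        s * (1 ⊗ₜ applySnd φ t) := by
      intro s t
      induction s using TensorProduct.induction_on with
      | zero => simp
      | add s s' hs hs' => simp only [add_tmul, add_mul, map_add, hs, hs']
      | tmul a b =>
      induction t using TensorProduct.induction_on with
      | zero => simp
      | tmul c d => simp
      | add s t hs ht => simp only [tmul_add, mul_add, map_add, hs, ht]
    exact key s s

theorem piL_mem (x : A) : piL k x ∈ baseL k A := applyFst_comul_one_mem _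

theorem piR_mem (x : A) : piR k x ∈ baseR k A := applySnd_comul_one_mem _

theorem piLBar_mem (x : A) : piLBar k x ∈ baseR k A := applySnd_comul_one_mem _

theorem piRBar_mem (x : A) : piRBar k x ∈ baseL k A := applyFst_comul_one_mem _

theorem map_piR_piL_comul_one :
    TensorProduct.map (piRHom k A) (piLHom k A) (comul (R := k) (1 : A)) = comul 1 := by
  have h1 : TensorProduct.map LinearMap.id (piLHom k A) (comul (R := k) (1 : A)) = comul 1 := by
    apply ext_applyFst
    intro φ
    rw [applyFst_map, piLHom_apply, LinearMap.comp_id, piL_of_mem (applyFst_comul_one_mem φ)]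
  have h2 : TensorProduct.map (piRHom k A) LinearMap.id (comul (R := k) (1 : A)) = comul 1 := by
    apply ext_applySnd
    intro φ
    rw [applySnd_map, piRHom_apply, LinearMap.comp_id, piR_of_mem (applySnd_comul_one_mem φ)]
  conv_lhs => rw [← LinearMap.comp_id (piRHom k A), ← LinearMap.id_comp (piLHom k A),
    TensorProduct.map_comp]
  rw [LinearMap.comp_apply, h1, h2]

variable (k A) in
/-- `Δ(1)` is a sum of tensors `u ⊗ v` with `u ∈ A^R` and `v ∈ A^L`. -/
theorem exists_repr_one : ∃ r : Coalgebra.Repr k (1 : A) (A × A),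
    (∀ i, r.left i ∈ baseR k A) ∧ ∀ i, r.right i ∈ baseL k A := by
  let r := ℛ k (1 : A)
  refine ⟨⟨r.index, fun i => piR k (r.left i), fun i => piL k (r.right i), ?_⟩,
    fun i => piR_mem _, fun i => piL_mem _⟩
  conv_rhs => rw [← map_piR_piL_comul_one, ← r.eq]
  simp [piLHom_apply, piRHom_apply]

/-- Writes φ ∘ Π^L as ε(y ·) with y in A^R. Contracting it with a leg of Δ(x) then reduces to the
counit axiom for yx. -/
theorem dual_piL (φ : Module.Dual k A) (a : A) :
    φ (piL k a) = counit (R := k) (applySnd φ (comul 1) * a) := by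
  rw [piL, apply_applyFst]
  exact (apply_applySnd φ (counit ∘ₗ LinearMap.mulRight k a) _).symm

theorem dual_piR (φ : Module.Dual k A) (a : A) :
    φ (piR k a) = counit (R := k) (a * applyFst φ (comul 1)) := by
  rw [piR, apply_applySnd]
  exact (apply_applyFst φ (counit ∘ₗ LinearMap.mulLeft k a) _).symm

theorem dual_piLBar (φ : Module.Dual k A) (a : A) :
    φ (piLBar k a) = counit (R := k) (applyFst φ (comul 1) * a) := by
  rw [piLBar, apply_applySnd]
  exact (apply_applyFst φ (counit ∘ₗ LinearMap.mulRight k a) _).symm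

/-- `x₍₁₎ ⊗ Π^L(x₍₂₎) = 1₍₁₎ x ⊗ 1₍₂₎`. -/
theorem map_id_piL_comul (x : A) :
    TensorProduct.map LinearMap.id (piLHom k A) (comul (R := k) x) = comul 1 * (x ⊗ₜ 1) := by
  refine ext_applySnd fun φ => ?_
  have e : φ ∘ₗ piLHom k A = counit ∘ₗ LinearMap.mulLeft k (applySnd φ (comul 1)) := by
    ext a; simp [piLHom_apply, dual_piL]
  rw [applySnd_map, e, ← applySnd_one_tmul_mul, ← comul_baseR_mul (applySnd_comul_one_mem φ),
    applySnd_counit_comul, applySnd_mul_tmul_one, LinearMap.id_apply]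

/-- `Π^R(x₍₁₎) ⊗ x₍₂₎ = 1₍₁₎ ⊗ x 1₍₂₎`. -/
theorem map_piR_id_comul (x : A) :
    TensorProduct.map (piRHom k A) LinearMap.id (comul (R := k) x) = (1 ⊗ₜ x) * comul 1 := by
  refine ext_applyFst fun φ => ?_
  have e : φ ∘ₗ piRHom k A = counit ∘ₗ LinearMap.mulRight k (applyFst φ (comul 1)) := by
    ext a; simp [piRHom_apply, dual_piR]
  rw [applyFst_map, e, ← applyFst_mul_tmul_one, ← comul_mul_baseL (applyFst_comul_one_mem φ),
    applyFst_counit_comul, applyFst_one_tmul_mul, LinearMap.id_apply]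

/-- `φ(1₍₁₎ ε(1₍₂₎ x₍₁₎)) x₍₂₎ = φ(1₍₁₎) 1₍₂₎ x`. -/
theorem applyFst_piLBar_comul (φ ψ : Module.Dual k A) (h : ∀ a, ψ a = φ (piLBar k a)) (x : A) :
    applyFst ψ (comul x) = applyFst φ (comul 1) * x := by
  have e : ψ = counit ∘ₗ LinearMap.mulLeft k (applyFst φ (comul 1)) := by
    ext a; simp [h, dual_piLBar]
  rw [e, ← applyFst_tmul_one_mul, ← comul_baseL_mul (applyFst_comul_one_mem φ),
    applyFst_counit_comul]

/-- `Π^L(x₍₁₎) x₍₂₎ = x`. -/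
theorem conv_piLHom_id : conv (piLHom k A) LinearMap.id = LinearMap.id := by
  have key : ∀ t : A ⊗[k] A, LinearMap.mul' k A (TensorProduct.map (piLHom k A) LinearMap.id t) =
      applyFst counit (comul (R := k) 1 * t) := by
    intro t
    induction t using TensorProduct.induction_on with
    | zero => simp
    | add s t hs ht => simp only [mul_add, map_add, hs, ht]
    | tmul a b =>
      have e : a ⊗ₜ[k] b = (a ⊗ₜ 1) * (1 ⊗ₜ b) := by simp
      rw [e, ← mul_assoc, applyFst_mul_one_tmul, applyFst_mul_tmul_one, ← e]
      simp [piLHom_apply, piL]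
  ext x
  rw [conv_apply, key, ← comul_eq_one_mul, applyFst_counit_comul, LinearMap.id_apply]

/-! ### The antipode reverses products and coproducts -/

theorem conv_tmul {B : Type*} [Ring B] [Algebra k B] (F G : A ⊗[k] A →ₗ[k] B) (x y : A) :
    conv F G (x ⊗ₜ y) = ∑ i ∈ (ℛ k x).index, ∑ j ∈ (ℛ k y).index,
      F ((ℛ k x).left i ⊗ₜ (ℛ k y).left j) * G ((ℛ k x).right i ⊗ₜ (ℛ k y).right j) := by
  rw [conv_apply, TensorProduct.comul_tmul]
  conv_lhs => rw [← (ℛ k x).eq, ← (ℛ k y).eq]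
  simp [sum_tmul, tmul_sum, Finset.sum_comm (s := (ℛ k y).index)]

theorem conv_comp_mul (p q : A →ₗ[k] A) (x y : A) :
    conv (p ∘ₗ LinearMap.mul' k A) (q ∘ₗ LinearMap.mul' k A) (x ⊗ₜ[k] y) = conv p q (x * y) := by
  rw [conv_tmul, conv_apply, comul_mul]
  conv_rhs => rw [← (ℛ k x).eq, ← (ℛ k y).eq]
  simp [Finset.sum_mul_sum]

variable (k A) in
/-- `x ⊗ y ↦ S(y) S(x)`. -/
def antiMulAnti : A ⊗[k] A →ₗ[k] A :=
  LinearMap.mul' k A ∘ₗ TensorProduct.map (anti k A) (anti k A) ∘ₗ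
    (TensorProduct.comm k A A).toLinearMap

@[simp] theorem antiMulAnti_tmul (x y : A) :
    antiMulAnti k A (x ⊗ₜ y) = anti k A y * anti k A x := by
  simp [antiMulAnti]

theorem conv_mul_antiMulAnti :
    conv (LinearMap.mul' k A) (antiMulAnti k A) = piLHom k A ∘ₗ LinearMap.mul' k A := by
  refine TensorProduct.ext' fun x y => ?_
  have h1 : piL k y = ∑ j ∈ (ℛ k y).index, (ℛ k y).left j * anti k A ((ℛ k y).right j) := by
    rw [← piLHom_apply, piLHom, conv_repr _ _ (ℛ k y)]; simp
  have h2 : piL k (x * y) = ∑ i ∈ (ℛ k x).index,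
      (ℛ k x).left i * piL k y * anti k A ((ℛ k x).right i) := by
    rw [← piL_mul_piL, ← piLHom_apply, piLHom, conv_apply, comul_mul_baseL (piL_mem y)]
    conv_lhs => rw [← (ℛ k x).eq]
    simp [Finset.sum_mul]
  rw [conv_tmul, LinearMap.comp_apply, LinearMap.mul'_apply, piLHom_apply, h2, h1]
  simp [Finset.mul_sum, Finset.sum_mul, mul_assoc]

theorem conv_antiMulAnti_mul (x y : A) :
    conv (antiMulAnti k A) (LinearMap.mul' k A) (x ⊗ₜ y) =
      conv (anti k A) (LinearMap.mulLeft k (piR k x) ∘ₗ LinearMap.id) y := by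
  have h1 : piR k x = ∑ j ∈ (ℛ k x).index, anti k A ((ℛ k x).left j) * (ℛ k x).right j := by
    rw [← piRHom_apply, piRHom, conv_repr _ _ (ℛ k x)]; simp
  rw [conv_tmul, conv_repr _ _ (ℛ k y), h1, Finset.sum_comm]
  simp [Finset.mul_sum, Finset.sum_mul, mul_assoc]

theorem conv_antiMulAnti_mul' :
    conv (antiMulAnti k A) (LinearMap.mul' k A) = piRHom k A ∘ₗ LinearMap.mul' k A := by
  refine TensorProduct.ext' fun x y => ?_
  rw [conv_antiMulAnti_mul, LinearMap.comp_apply, LinearMap.mul'_apply, piRHom_apply,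
    ← piR_piR_mul, ← piRHom_apply (piR k x * y), piRHom, conv_apply, conv_apply, comul_baseR_mul (piR_mem x)]
  conv_lhs => rw [← (ℛ k y).eq]
  conv_rhs => rw [← (ℛ k y).eq]
  simp [Finset.mul_sum]

theorem conv_antiMulAnti_mul_antiMulAnti :
    conv (conv (antiMulAnti k A) (LinearMap.mul' k A)) (antiMulAnti k A) = antiMulAnti k A := by
  refine TensorProduct.ext' fun x y => ?_
  have h1 : ∀ a ∈ baseR k A, conv (conv (anti k A) (LinearMap.mulLeft k a ∘ₗ LinearMap.id))
      (anti k A) y = anti k A y * a := by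
    intro a ha
    conv_rhs => rw [← conv_anti_piLHom]
    rw [conv_assoc, mulLeft_comp_conv, ← piLHom, conv_repr _ _ (ℛ k y), conv_repr _ _ (ℛ k y),
      Finset.sum_mul]
    refine Finset.sum_congr rfl fun j _ => ?_
    rw [LinearMap.comp_apply, LinearMap.mulLeft_apply, piLHom_apply,
      ← baseL_comm_baseR (piL_mem _) ha, mul_assoc]
  rw [conv_tmul, antiMulAnti_tmul]
  have h2 : anti k A x = ∑ i ∈ (ℛ k x).index,
      piRHom k A ((ℛ k x).left i) * anti k A ((ℛ k x).right i) := by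
    rw [← conv_repr, conv_piRHom_anti]
  rw [h2, Finset.mul_sum]
  refine Finset.sum_congr rfl fun i _ => ?_
  rw [piRHom_apply, ← mul_assoc, ← h1 _ (piR_mem _),
    conv_repr _ _ (ℛ k y), Finset.sum_mul]
  refine Finset.sum_congr rfl fun j _ => ?_
  rw [conv_antiMulAnti_mul, antiMulAnti_tmul, mul_assoc]

/-- The antipode is antimultiplicative. -/
theorem anti_mul (x y : A) : anti k A (x * y) = anti k A y * anti k A x := by
  let m := LinearMap.mul' k A
  have h1 : conv (anti k A ∘ₗ m) m = piRHom k A ∘ₗ m :=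
    TensorProduct.ext' fun x y => by
      have := conv_comp_mul (anti k A) LinearMap.id x y
      rw [LinearMap.id_comp] at this
      rw [this]; rfl
  have h2 : conv m (anti k A ∘ₗ m) = piLHom k A ∘ₗ m :=
    TensorProduct.ext' fun x y => by
      have := conv_comp_mul LinearMap.id (anti k A) x y
      rw [LinearMap.id_comp] at this
      rw [this]; rfl
  have h3 : conv (conv (anti k A ∘ₗ m) m) (anti k A ∘ₗ m) = anti k A ∘ₗ m :=
    TensorProduct.ext' fun x y => by
      rw [h1, conv_comp_mul, conv_piRHom_anti]; rfl
  -- Uniqueness of a generalized convolution inverse in Hom(A ⊗ A, A): both maps f satisfy f * m * f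
  -- = f, with the same f * m = Π^R ∘ m and the same m * f = Π^L ∘ m.
  have key : anti k A ∘ₗ m = antiMulAnti k A := by
    rw [← h3, conv_assoc, h2, ← conv_mul_antiMulAnti, ← conv_assoc, h1, ← conv_antiMulAnti_mul',
      conv_antiMulAnti_mul_antiMulAnti]
  simpa [m] using LinearMap.congr_fun key (x ⊗ₜ y)

/-- For y in A^R, Δ(y) = (1 ⊗ y)Δ(1), hence y₍₁₎ S(y₍₂₎) = 1₍₁₎ S(1₍₂₎) S(y) = S(y). -/
theorem anti_of_mem_baseR {y : A} (hy : y ∈ baseR k A) : anti k A y = piL k y := by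
  have h : piL k y = piL k 1 * anti k A y := by
    rw [← piLHom_apply, ← piLHom_apply, piLHom, conv_apply, conv_apply, hy.1]
    rw [← (ℛ k (1 : A)).eq]
    simp [Finset.mul_sum, Finset.sum_mul, anti_mul, mul_assoc]
  rw [h, piL_one, one_mul]

theorem anti_of_mem_baseL {y : A} (hy : y ∈ baseL k A) : anti k A y = piR k y := by
  have h : piR k y = anti k A y * piR k 1 := by
    rw [← piRHom_apply, ← piRHom_apply, piRHom, conv_apply, conv_apply, hy.2]
    rw [← (ℛ k (1 : A)).eq]
    simp [Finset.mul_sum, Finset.sum_mul, anti_mul, mul_assoc]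
  rw [h, piR_one, mul_one]

theorem anti_one : anti k A 1 = 1 := by
  rw [anti_of_mem_baseR (one_mem _), piL_one]

theorem anti_mem_baseL {y : A} (hy : y ∈ baseR k A) : anti k A y ∈ baseL k A := by
  rw [anti_of_mem_baseR hy]; exact piL_mem y

theorem anti_mem_baseR {y : A} (hy : y ∈ baseL k A) : anti k A y ∈ baseR k A := by
  rw [anti_of_mem_baseL hy]; exact piR_mem y

theorem counit_anti_of_mem_baseR {y : A} (hy : y ∈ baseR k A) :
    counit (R := k) (anti k A y) = counit (R := k) y := by
  simpa [anti_of_mem_baseR hy] using counit_mul_piL (k := k) 1 y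

theorem counit_anti_of_mem_baseL {y : A} (hy : y ∈ baseL k A) :
    counit (R := k) (anti k A y) = counit (R := k) y := by
  simpa [anti_of_mem_baseL hy] using counit_piR_mul (k := k) y 1

variable (k A) in
/-- `x ⊗ y ↦ S(y) ⊗ S(x)`. -/
def antiTwist : A ⊗[k] A →ₗ[k] A ⊗[k] A :=
  (TensorProduct.comm k A A).toLinearMap ∘ₗ TensorProduct.map (anti k A) (anti k A)

@[simp] theorem antiTwist_tmul (x y : A) :
    antiTwist k A (x ⊗ₜ y) = anti k A y ⊗ₜ anti k A x := by
  simp [antiTwist]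

theorem antiTwist_mul (s t : A ⊗[k] A) :
    antiTwist k A (s * t) = antiTwist k A t * antiTwist k A s := by
  induction s using TensorProduct.induction_on with
  | zero => simp
  | add s s' hs hs' => simp only [add_mul, mul_add, map_add, hs, hs']
  | tmul a b =>
  induction t using TensorProduct.induction_on with
  | zero => simp
  | tmul c d => simp [anti_mul]
  | add s t hs ht => simp only [add_mul, mul_add, map_add, hs, ht]

/-- On the legs of Δ(1) the antipode coincides with a counital map, so this case of
anticomultiplicativity comes first; the general case relies on it. -/
theorem antiTwist_comul_one : antiTwist k A (comul 1) = comul 1 := by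
  refine ext_applyFst fun φ => ?_
  obtain ⟨r, hr, hr'⟩ := exists_repr_one k A
  have h1 : applySnd (φ ∘ₗ anti k A) (comul 1) = piLBar k (applyFst φ (comul 1)) := by
    rw [piLBar]
    conv_lhs => rw [← r.eq]
    conv_rhs => arg 2; rw [← r.eq]
    simp only [map_sum, applySnd_tmul]
    refine Finset.sum_congr rfl fun i _ => ?_
    rw [LinearMap.comp_apply, anti_of_mem_baseL (hr' i), dual_piR]
    rfl
  rw [antiTwist, LinearMap.comp_apply, LinearEquiv.coe_coe, applyFst_comm, applySnd_map, h1,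
    anti_of_mem_baseR (piLBar_mem _), piL_piLBar, piL_of_mem (applyFst_comul_one_mem φ)]

theorem comul_comp_conv (f g : A →ₗ[k] A) :
    comul ∘ₗ conv f g = conv (comul (R := k) ∘ₗ f) (comul ∘ₗ g) := by
  ext x
  simp [conv_repr _ _ (ℛ k x), comul_mul]

theorem comul_eq_conv : comul (R := k) (A := A) =
    conv (Algebra.TensorProduct.includeLeft : A →ₐ[k] A ⊗[k] A).toLinearMap
      (Algebra.TensorProduct.includeRight : A →ₐ[k] A ⊗[k] A).toLinearMap := by
  ext x
  rw [conv_repr _ _ (ℛ k x), ← (ℛ k x).eq]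
  simp

theorem conv_includeLeft_piLHom :
    conv (Algebra.TensorProduct.includeLeft : A →ₐ[k] A ⊗[k] A).toLinearMap
      ((Algebra.TensorProduct.includeRight : A →ₐ[k] A ⊗[k] A).toLinearMap ∘ₗ piLHom k A) =
    LinearMap.mulLeft k (comul 1) ∘ₗ
      (Algebra.TensorProduct.includeLeft : A →ₐ[k] A ⊗[k] A).toLinearMap := by
  ext x
  refine Eq.trans ?_ (map_id_piL_comul x)
  rw [conv_repr _ _ (ℛ k x), ← (ℛ k x).eq]
  simp

/-- The antipode is anticomultiplicative. -/
theorem comul_anti (x : A) : comul (anti k A x) = antiTwist k A (comul x) := by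
  let i₁ : A →ₐ[k] A ⊗[k] A := Algebra.TensorProduct.includeLeft
  let i₂ : A →ₐ[k] A ⊗[k] A := Algebra.TensorProduct.includeRight
  let G := conv (i₂.toLinearMap ∘ₗ anti k A) (i₁.toLinearMap ∘ₗ anti k A)
  have hG : G = antiTwist k A ∘ₗ comul := by
    ext x
    rw [LinearMap.comp_apply, conv_repr _ _ (ℛ k x)]
    conv_rhs => rw [← (ℛ k x).eq]
    simp [i₁, i₂]
  have hΔ : comul (R := k) = conv i₁.toLinearMap i₂.toLinearMap := comul_eq_conv
  have hL : conv i₁.toLinearMap (i₂.toLinearMap ∘ₗ piLHom k A) =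
      LinearMap.mulLeft k (comul 1) ∘ₗ i₁.toLinearMap := conv_includeLeft_piLHom
  have hmul : conv comul G = comul ∘ₗ piLHom k A := by
    rw [hΔ, conv_assoc, ← conv_assoc i₂.toLinearMap,
      ← LinearMap.comp_id i₂.toLinearMap, LinearMap.comp_assoc, LinearMap.id_comp,
      ← algHom_comp_conv, ← piLHom, ← conv_assoc, hL, mulLeft_comp_conv,
      ← LinearMap.comp_id i₁.toLinearMap, LinearMap.comp_assoc, LinearMap.id_comp,
      ← algHom_comp_conv, ← piLHom]
    rw [LinearMap.comp_id, LinearMap.comp_id, ← hΔ]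
    ext x
    simpa [i₁, piLHom_apply] using (piL_mem (k := k) x).2.symm
  have hR : comul ∘ₗ piRHom k A =
      LinearMap.mulLeft k (comul 1) ∘ₗ i₂.toLinearMap ∘ₗ piRHom k A := by
    ext x
    simpa [i₂, piRHom_apply] using (piR_mem (k := k) x).2
  have hone : LinearMap.mulLeft k (comul 1) ∘ₗ G = G := by
    ext x
    simp only [hG, LinearMap.comp_apply, LinearMap.mulLeft_apply]
    conv_rhs => rw [comul_eq_mul_one x, antiTwist_mul, antiTwist_comul_one]
  have key : comul ∘ₗ anti k A = G := by
    have h1 : conv (comul ∘ₗ anti k A) (comul (R := k)) = comul ∘ₗ piRHom k A := by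
      rw [piRHom, comul_comp_conv, LinearMap.comp_id]
    have h2 : conv (comul (R := k)) (comul ∘ₗ anti k A) = comul ∘ₗ piLHom k A := by
      rw [piLHom, comul_comp_conv, LinearMap.comp_id]
    -- Generalized inverses of Δ in Hom(A, A ⊗ A) are compared here. Since Δ * G = Δ * (Δ ∘ S), the
    -- last factor may be replaced by G, and Δ(1)G = G absorbs the remaining unit.
    calc comul ∘ₗ anti k A
        = conv (conv (comul ∘ₗ anti k A) comul) (comul ∘ₗ anti k A) := by
          rw [h1, ← comul_comp_conv, conv_piRHom_anti]
      _ = conv (conv (comul ∘ₗ anti k A) comul) G := by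
          rw [conv_assoc, h2, ← hmul, conv_assoc]
      _ = LinearMap.mulLeft k (comul 1) ∘ₗ G := by
          rw [h1, hR, mulLeft_comp_conv, ← conv_assoc, ← algHom_comp_conv, conv_piRHom_anti]
      _ = G := hone
  rw [hG] at key
  exact LinearMap.congr_fun key x

theorem piL_anti (x : A) : piL k (anti k A x) = anti k A (piR k x) := by
  rw [← piLHom_apply, ← piRHom_apply, piLHom, piRHom, conv_apply, conv_apply, comul_anti]
  rw [← (ℛ k x).eq]
  simp [anti_mul]

theorem piR_anti (x : A) : piR k (anti k A x) = anti k A (piL k x) := by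
  rw [← piLHom_apply, ← piRHom_apply, piLHom, piRHom, conv_apply, conv_apply, comul_anti]
  rw [← (ℛ k x).eq]
  simp [anti_mul]

/-! ### Haar integrals and the Casimir tensor -/

/-- The product h'h is h by left invariance of h and h' by right invariance of h'. -/
theorem IsHaarIntegral.eq {h h' : A} (hh : IsHaarIntegral k h) (hh' : IsHaarIntegral k h') :
    h = h' := by
  have e := hh.left_integral h'
  rw [hh'.left_normalized, one_mul, hh'.right_integral, hh.right_normalized, mul_one] at e
  exact e.symm

theorem IsHaarIntegral.anti {h : A} (hh : IsHaarIntegral k h)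
    (hS : Function.Surjective (anti k A)) : IsHaarIntegral k (anti k A h) where
  left_integral x := by
    obtain ⟨x, rfl⟩ := hS x
    rw [← anti_mul, hh.right_integral, anti_mul, piL_anti]
  right_integral x := by
    obtain ⟨x, rfl⟩ := hS x
    rw [← anti_mul, hh.left_integral, anti_mul, piR_anti]
  left_normalized := by rw [piL_anti, hh.right_normalized, anti_one]
  right_normalized := by rw [piR_anti, hh.left_normalized, anti_one]

/-- `h₍₁₎ x ⊗ h₍₂₎ = h₍₁₎ ⊗ h₍₂₎ S(x)`. -/
theorem IsHaarIntegral.comul_mul_tmul_one {h : A} (hh : IsHaarIntegral k h) (x : A) :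
    comul (R := k) h * (x ⊗ₜ 1) = comul h * (1 ⊗ₜ WeakHopfAlgebra.anti k A x) := by
  let i₁ : A →ₐ[k] A ⊗[k] A := Algebra.TensorProduct.includeLeft
  let i₂ : A →ₐ[k] A ⊗[k] A := Algebra.TensorProduct.includeRight
  have hΔ : comul (R := k) = conv i₁.toLinearMap i₂.toLinearMap := comul_eq_conv
  have hL : conv i₁.toLinearMap (i₂.toLinearMap ∘ₗ piLHom k A) =
      LinearMap.mulLeft k (comul 1) ∘ₗ i₁.toLinearMap := conv_includeLeft_piLHom
  have h1 : conv comul (i₂.toLinearMap ∘ₗ WeakHopfAlgebra.anti k A) =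
      LinearMap.mulLeft k (comul 1) ∘ₗ i₁.toLinearMap := by
    rw [← hL, piLHom, algHom_comp_conv, LinearMap.comp_id, ← conv_assoc, ← hΔ]
  have h2 : LinearMap.mulLeft k (comul h) ∘ₗ comul =
      LinearMap.mulLeft k (comul h) ∘ₗ i₂.toLinearMap ∘ₗ piRHom k A := by
    ext x
    have : comul (R := k) h * comul x = comul h * (1 ⊗ₜ piR k x) := by
      rw [← comul_mul, hh.right_integral, comul_mul_baseR (piR_mem x)]
    simpa [i₂, piRHom_apply] using this
  -- Evaluate Δ(h)Δ(x₍₁₎)(1 ⊗ S(x₍₂₎)) in two ways: integrality turns Δ(h x₍₁₎) into Δ(h)(1 ⊗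
  -- Π^R(x₍₁₎)), while x₍₁₎ ⊗ x₍₂₎ S(x₍₃₎) collapses to Δ(1)(x ⊗ 1).
  have h3 := mulLeft_comp_conv (comul h) comul (i₂.toLinearMap ∘ₗ WeakHopfAlgebra.anti k A)
  rw [h2, mulLeft_comp_conv, ← algHom_comp_conv, conv_piRHom_anti, h1] at h3
  have h4 := LinearMap.congr_fun h3 x
  simp only [LinearMap.comp_apply, LinearMap.mulLeft_apply] at h4
  rw [← mul_assoc, ← comul_eq_mul_one] at h4
  exact h4.symm

variable (k) in
/-- The tensor `S(h₍₁₎) ⊗ h₍₂₎`. -/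
def casimir (h : A) : A ⊗[k] A := TensorProduct.map (anti k A) LinearMap.id (comul h)

theorem map_anti_mul_tmul_one (s : A ⊗[k] A) (x : A) :
    TensorProduct.map (anti k A) LinearMap.id (s * (x ⊗ₜ 1)) =
      (anti k A x ⊗ₜ 1) * TensorProduct.map (anti k A) LinearMap.id s := by
  induction s using TensorProduct.induction_on with
  | zero => simp
  | tmul a b => simp [anti_mul]
  | add s t hs ht => simp only [add_mul, mul_add, map_add, hs, ht]

theorem map_anti_mul_one_tmul (s : A ⊗[k] A) (x : A) :
    TensorProduct.map (anti k A) LinearMap.id (s * (1 ⊗ₜ x)) =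
      TensorProduct.map (anti k A) LinearMap.id s * (1 ⊗ₜ x) := by
  induction s using TensorProduct.induction_on with
  | zero => simp
  | tmul a b => simp
  | add s t hs ht => simp only [add_mul, map_add, hs, ht]

theorem applySnd_comul_applyFst (φ ψ : Module.Dual k A) (x : A) :
    applySnd φ (comul (applyFst ψ (comul x))) = applyFst ψ (comul (applySnd φ (comul x))) := by
  rw [← comul_applyFst, ← comul_applySnd]
  generalize TensorProduct.map comul LinearMap.id (comul (R := k) x) = t
  induction t using TensorProduct.induction_on with
  | zero => simp
  | add s t hs ht => simp only [map_add, hs, ht]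
  | tmul s c =>
  induction s using TensorProduct.induction_on with
  | zero => simp
  | tmul a b => simp [smul_smul]
  | add s t hs ht => simp only [add_tmul, map_add, hs, ht]

/-! ### The density d and the dual functional λ -/

/-- A Haar integral `h` together with a nondegenerate trace `tr`. -/
structure IsTraceFrame (h : A) (tr : Module.Dual k A) : Prop where
  haar : IsHaarIntegral k h
  surj : Function.Surjective (anti k A)
  inj : Function.Injective (anti k A)
  comm : ∀ x y, tr (x * y) = tr (y * x)
  nondeg : ∀ x, (∀ y, tr (x * y) = 0) → x = 0

/-- `d = S(h₍₁₎) tr(h₍₂₎)`. -/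
def density (h : A) (tr : Module.Dual k A) : A := applySnd tr (casimir k h)

/-- The functional `λ = tr(d⁻¹ ·)`. -/
def dualIntegral (h : A) (tr : Module.Dual k A) : Module.Dual k A :=
  tr ∘ₗ LinearMap.mulLeft k (Ring.inverse (density h tr))

namespace IsTraceFrame

variable {h : A} {tr : Module.Dual k A} (F : IsTraceFrame h tr)
include F

theorem anti_haar : anti k A h = h := (F.haar.anti F.surj).eq F.haar

theorem tmul_one_mul_casimir (y : A) : (y ⊗ₜ 1) * casimir k h = casimir k h * (1 ⊗ₜ y) := by
  obtain ⟨x, rfl⟩ := F.surj y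
  rw [casimir, ← map_anti_mul_tmul_one, F.haar.comul_mul_tmul_one, map_anti_mul_one_tmul]

theorem mul'_casimir : LinearMap.mul' k A (casimir k h) = 1 := by
  rw [← F.haar.right_normalized, ← piRHom_apply]; rfl

theorem casimir_symm : casimir k h = TensorProduct.map (anti k A ∘ₗ anti k A) LinearMap.id
    (TensorProduct.comm k A A (casimir k h)) := by
  have e : comul h = antiTwist k A (comul h) := by
    rw [← comul_anti, F.anti_haar]
  conv_lhs => rw [casimir, e]
  rw [casimir]
  generalize comul (R := k) h = s
  induction s using TensorProduct.induction_on with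
  | zero => simp
  | tmul a b => simp
  | add s t hs ht => simp only [map_add, hs, ht]

theorem applySnd_casimir (x : A) :
    applySnd (tr ∘ₗ LinearMap.mulRight k x) (casimir k h) = x * density h tr := by
  rw [← applySnd_mul_one_tmul, ← F.tmul_one_mul_casimir, applySnd_tmul_one_mul, density]

/-- Contract both legs of c with tr(y ·) and tr(· x). The order is immaterial, so `applySnd_casimir`
determines this slice by nondegeneracy of tr. -/
theorem applyFst_casimir (y : A) :
    applyFst (tr ∘ₗ LinearMap.mulLeft k y) (casimir k h) = density h tr * y := by
  rw [← sub_eq_zero]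
  refine F.nondeg _ fun x => ?_
  have h1 : tr (applyFst (tr ∘ₗ LinearMap.mulLeft k y) (casimir k h) * x) =
      tr (y * (x * density h tr)) := by
    have e1 := apply_applyFst (tr ∘ₗ LinearMap.mulLeft k y) (tr ∘ₗ LinearMap.mulRight k x)
      (casimir k h)
    have e2 := apply_applySnd (tr ∘ₗ LinearMap.mulRight k x) (tr ∘ₗ LinearMap.mulLeft k y)
      (casimir k h)
    rw [← e2, F.applySnd_casimir] at e1
    exact e1
  rw [sub_mul, map_sub, h1, ← mul_assoc, F.comm (y * x), mul_assoc, sub_self]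

/-- Both sides are the slice of c by tr(· x) in the second leg, computed directly and through
`casimir_symm`. -/
theorem mul_density (x : A) : x * density h tr = anti k A (anti k A (density h tr * x)) := by
  rw [← F.applySnd_casimir]
  conv_lhs => rw [F.casimir_symm, applySnd_map, LinearMap.comp_id]
  have e : tr ∘ₗ LinearMap.mulRight k x = tr ∘ₗ LinearMap.mulLeft k x :=
    LinearMap.ext fun a => F.comm a x
  rw [applySnd_comm, e, F.applyFst_casimir]
  rfl

theorem anti_anti_density : anti k A (anti k A (density h tr)) = density h tr := by
  simpa using (F.mul_density 1).symm

theorem mul_density' (x : A) : x * density h tr = density h tr * anti k A (anti k A x) := by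
  rw [F.mul_density, anti_mul, anti_mul, F.anti_anti_density]

omit F in
theorem dualIntegral_apply (x : A) :
    dualIntegral h tr x = tr (Ring.inverse (density h tr) * x) := rfl

variable [FiniteDimensional k A]

theorem exists_eq_trace (φ : Module.Dual k A) : ∃ y, φ = tr ∘ₗ LinearMap.mulRight k y := by
  let T : A →ₗ[k] Module.Dual k A := (LinearMap.mul k A).flip.compr₂ tr
  have hT : Function.Injective T := by
    rw [injective_iff_map_eq_zero]
    exact fun y hy => F.nondeg y fun x => by rw [F.comm]; exact LinearMap.congr_fun hy x
  obtain ⟨y, hy⟩ := (LinearMap.injective_iff_surjective_of_finrank_eq_finrank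
    (Subspace.dual_finrank_eq (K := k) (V := A)).symm).mp hT φ
  exact ⟨y, by rw [← hy]; rfl⟩

theorem eq_zero_of_density_mul {x : A} (hx : density h tr * x = 0) : x = 0 := by
  -- Every functional is tr(· y), and slicing with it gives x y d = S²(d x y) = 0. Multiplying the
  -- legs of c(1 ⊗ x) then recovers x.
  have h1 : casimir k h * (1 ⊗ₜ x) = 0 := by
    refine ext_applySnd fun φ => ?_
    obtain ⟨y, rfl⟩ := F.exists_eq_trace φ
    have e : ((1 : A) ⊗ₜ[k] x) * (1 ⊗ₜ y) = 1 ⊗ₜ (x * y) := by simp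
    rw [← applySnd_mul_one_tmul, mul_assoc, e, applySnd_mul_one_tmul, F.applySnd_casimir,
      F.mul_density, ← mul_assoc, hx]
    simp
  have h2 := mul'_mul_one_tmul (casimir k h) x
  rw [h1, F.mul'_casimir, one_mul, map_zero] at h2
  exact h2.symm

theorem isUnit_density : IsUnit (density h tr) := by
  have hinj : Function.Injective (LinearMap.mulLeft k (density h tr)) := by
    rw [injective_iff_map_eq_zero]
    exact fun x hx => F.eq_zero_of_density_mul hx
  obtain ⟨y, hy⟩ := LinearMap.injective_iff_surjective.mp hinj 1
  rw [LinearMap.mulLeft_apply] at hy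
  refine ⟨⟨density h tr, y, hy, ?_⟩, rfl⟩
  rw [← sub_eq_zero]
  apply F.eq_zero_of_density_mul
  rw [mul_sub, ← mul_assoc, hy, one_mul, mul_one, sub_self]

theorem density_mul_inverse : density h tr * Ring.inverse (density h tr) = 1 :=
  Ring.mul_inverse_cancel _ F.isUnit_density

theorem inverse_mul_density : Ring.inverse (density h tr) * density h tr = 1 :=
  Ring.inverse_mul_cancel _ F.isUnit_density

theorem inverse_density_mul (x : A) : Ring.inverse (density h tr) * x =
    anti k A (anti k A x) * Ring.inverse (density h tr) := by
  have h1 := congrArg (fun t => Ring.inverse (density h tr) * t * Ring.inverse (density h tr))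
    (F.mul_density' x)
  simp only [← mul_assoc] at h1
  rw [F.inverse_mul_density, one_mul, mul_assoc, F.density_mul_inverse, mul_one] at h1
  exact h1

theorem dualIntegral_mul (a b : A) :
    dualIntegral h tr (a * b) = dualIntegral h tr (b * anti k A (anti k A a)) := by
  rw [dualIntegral_apply, dualIntegral_apply, ← mul_assoc, F.inverse_density_mul, F.comm, F.comm _
    (b * _), mul_assoc]

theorem dualIntegral_anti_anti (a : A) :
    dualIntegral h tr (anti k A (anti k A a)) = dualIntegral h tr a := by
  simpa using (F.dualIntegral_mul a 1).symm

/-- `λ(x S(h₍₁₎)) h₍₂₎ = x`. -/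
theorem applyFst_dualIntegral_casimir (x : A) :
    applyFst (dualIntegral h tr ∘ₗ LinearMap.mulLeft k x) (casimir k h) = x := by
  have e : dualIntegral h tr ∘ₗ LinearMap.mulLeft k x =
      tr ∘ₗ LinearMap.mulLeft k (Ring.inverse (density h tr) * x) := by
    ext a; simp [dualIntegral_apply]
  rw [e, F.applyFst_casimir, ← mul_assoc, F.density_mul_inverse, one_mul]

/-- `S(h₍₁₎) λ(h₍₂₎ x) = x`. -/
theorem applySnd_dualIntegral_casimir (x : A) :
    applySnd (dualIntegral h tr ∘ₗ LinearMap.mulRight k x) (casimir k h) = x := by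
  have e : dualIntegral h tr ∘ₗ LinearMap.mulRight k x =
      tr ∘ₗ LinearMap.mulRight k (x * Ring.inverse (density h tr)) := by
    ext a
    simp [dualIntegral_apply, ← mul_assoc, F.comm _ (Ring.inverse _)]
  rw [e, F.applySnd_casimir, mul_assoc, F.inverse_mul_density, mul_one]

/-- `λ(x S(h₍₁₎)) h₍₂₎ = x`, before applying `S` to the first leg. -/
theorem applyFst_dualIntegral_comul (x : A) :
    applyFst (dualIntegral h tr ∘ₗ LinearMap.mulLeft k x ∘ₗ anti k A) (comul h) = x := by
  have := F.applyFst_dualIntegral_casimir x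
  rwa [casimir, applyFst_map] at this

/-- Strong invariance: `x₍₁₎ λ(x₍₂₎ S(u)) = λ(x S(u₍₁₎)) u₍₂₎`. -/
theorem strong_invariance (x u : A) :
    applySnd (dualIntegral h tr ∘ₗ LinearMap.mulRight k (anti k A u)) (comul x) =
      applyFst (dualIntegral h tr ∘ₗ LinearMap.mulLeft k x ∘ₗ anti k A) (comul u) := by
  have hu : applySnd (dualIntegral h tr ∘ₗ LinearMap.mulRight k (anti k A u)) (comul h) = u := by
    apply F.inj
    have := F.applySnd_dualIntegral_casimir (anti k A u)
    rwa [casimir, applySnd_map, LinearMap.comp_id] at this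
  -- Expand x as λ(x S(h₍₁₎)) h₍₂₎; by coassociativity the slice of Δ(x) can be taken on h first,
  -- where it produces u.
  conv_lhs => rw [← F.applyFst_dualIntegral_comul x]
  rw [applySnd_comul_applyFst, hu]

/-- Applying ε to λ(S(h₍₁₎)) y h₍₂₎ = y gives ε(y) = λ(S(yh)) = λ(h S²(y)), and λ(ab) = λ(b S²(a))
moves y back to the left. -/
theorem counit_baseR {y : A} (hy : y ∈ baseR k A) :
    counit (R := k) y = dualIntegral h tr (y * h) := by
  have h1 := F.applyFst_dualIntegral_comul 1
  have h2 : applyFst (dualIntegral h tr ∘ₗ LinearMap.mulLeft k 1 ∘ₗ anti k A) (comul (y * h)) = y := by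
    rw [comul_baseR_mul hy, applyFst_one_tmul_mul, h1, mul_one]
  have h3 := congrArg (counit (R := k)) h2
  rw [apply_applyFst, ← apply_applySnd, applySnd_counit_comul] at h3
  rw [← h3, LinearMap.comp_apply, LinearMap.comp_apply, LinearMap.mulLeft_apply, one_mul, anti_mul,
    F.anti_haar, F.haar.right_integral, ← anti_of_mem_baseL (anti_mem_baseL hy),
    ← F.dualIntegral_mul]

end IsTraceFrame

/-! ### Integrals of the dual and the Haar functional -/

theorem mem_baseR_of_anti_mem (hS : Function.Injective (anti k A)) {y : A}
    (hy : anti k A y ∈ baseL k A) : y ∈ baseR k A := by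
  have : piR k y = y := hS (by rw [← piL_anti, piL_of_mem hy])
  rw [← this]; exact piR_mem y

theorem exists_anti_eq (hS : Function.Surjective (anti k A)) {y : A} (hy : y ∈ baseR k A) :
    ∃ x ∈ baseL k A, anti k A x = y := by
  obtain ⟨x, rfl⟩ := hS y
  exact ⟨piL k x, piL_mem x, by rw [← piR_anti, piR_of_mem hy]⟩

theorem dualMul_apply (φ ψ : Module.Dual k A) (x : A) :
    dualMul φ ψ x = dualTensor φ ψ (comul x) := rfl

theorem dualPiL_apply (φ : Module.Dual k A) (x : A) : dualPiL φ x = φ (piL k x) :=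
  (apply_applyFst _ φ _).symm

theorem dualPiR_apply (φ : Module.Dual k A) (x : A) : dualPiR φ x = φ (piR k x) :=
  (apply_applySnd _ φ _).symm

theorem dualMul_counit (φ : Module.Dual k A) : dualMul φ counit = φ := by
  ext x
  rw [dualMul_apply, ← apply_applySnd, applySnd_counit_comul]

theorem counit_dualMul (φ : Module.Dual k A) : dualMul counit φ = φ := by
  ext x
  rw [dualMul_apply, ← apply_applyFst, applyFst_counit_comul]

theorem dual_left_integral {η : Module.Dual k A} (h : ∀ x, applySnd η (comul x) ∈ baseL k A)
    (φ : Module.Dual k A) : dualMul φ η = dualMul (dualPiL φ) η := by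
  ext x
  rw [dualMul_apply, dualMul_apply, ← apply_applySnd, ← apply_applySnd, dualPiL_apply,
    piL_of_mem (h x)]

theorem dual_right_integral {η : Module.Dual k A} (h : ∀ x, applyFst η (comul x) ∈ baseR k A)
    (φ : Module.Dual k A) : dualMul η φ = dualMul η (dualPiR φ) := by
  ext x
  rw [dualMul_apply, dualMul_apply, ← apply_applyFst, ← apply_applyFst, dualPiR_apply,
    piR_of_mem (h x)]

/-- A right normalized left integral agrees with any left normalized right integral. -/
theorem dual_integral_eq {η η' : Module.Dual k A}
    (hη : ∀ φ : Module.Dual k A, dualMul φ η = dualMul (dualPiL φ) η) (hηn : dualPiR η = counit)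
    (hη' : ∀ φ : Module.Dual k A, dualMul η' φ = dualMul η' (dualPiR φ))
    (hηn' : dualPiL η' = counit) : η = η' := by
  have := hη η'
  rw [hηn', counit_dualMul, hη', hηn, dualMul_counit] at this
  exact this.symm

theorem IsHaarFunctional.eq {η η' : Module.Dual k A} (h : IsHaarFunctional η)
    (h' : IsHaarFunctional η') : η = η' :=
  dual_integral_eq h.left_integral h.right_normalized h'.right_integral h'.left_normalized

/-- `1₍₁₎ z ⊗ 1₍₂₎ = 1₍₁₎ ⊗ 1₍₂₎ S(z)` for `z ∈ A^R`. -/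
theorem comul_one_mul_tmul_one {z : A} (hz : z ∈ baseR k A) :
    comul (R := k) 1 * (z ⊗ₜ 1) = comul 1 * (1 ⊗ₜ anti k A z) := by
  obtain ⟨r, -, hr⟩ := exists_repr_one k A
  rw [← map_id_piL_comul, hz.2, ← r.eq]
  simp only [Finset.sum_mul, Algebra.TensorProduct.tmul_mul_tmul, map_sum, TensorProduct.map_tmul, mul_one,
    LinearMap.id_apply, piLHom_apply]
  refine Finset.sum_congr rfl fun i _ => ?_
  rw [← piL_mul_piL, piL_of_mem (mul_mem (hr i) (piL_mem z)), anti_of_mem_baseR hz]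

/-- The functional `λ(· z)`. -/
def haarFunctional (h : A) (tr : Module.Dual k A) (z : A) : Module.Dual k A :=
  dualIntegral h tr ∘ₗ LinearMap.mulRight k z

theorem haarFunctional_apply (h : A) (tr : Module.Dual k A) (z x : A) :
    haarFunctional h tr z x = dualIntegral h tr (x * z) := rfl

/-- `z ∈ A^R` represents the counit on `A^R` with respect to `λ`. -/
structure IsCounitDensity (h : A) (tr : Module.Dual k A) (z : A) : Prop extends
    IsTraceFrame h tr where
  mem : z ∈ baseR k A
  apply_mul : ∀ y ∈ baseR k A, dualIntegral h tr (y * z) = counit (R := k) y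
  nondegR : ∀ a ∈ baseR k A, (∀ y ∈ baseR k A, dualIntegral h tr (y * a) = 0) → a = 0

namespace IsCounitDensity

variable {h : A} {tr : Module.Dual k A} {z : A} (D : IsCounitDensity h tr z)
  [FiniteDimensional k A]
include D

theorem strong_invariance' (x u : A) :
    applySnd (haarFunctional h tr z ∘ₗ LinearMap.mulRight k (anti k A u)) (comul x) =
      applyFst (haarFunctional h tr z ∘ₗ LinearMap.mulLeft k x ∘ₗ anti k A) (comul u) := by
  obtain ⟨w, hw, rfl⟩ := exists_anti_eq D.surj D.mem
  have h1 := D.strong_invariance x (w * u)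
  rw [comul_baseL_mul hw, applyFst_tmul_one_mul] at h1
  convert h1 using 2
  · congr 1; ext a; simp [haarFunctional_apply, anti_mul, mul_assoc]
  · congr 1; ext a; simp [haarFunctional_apply, anti_mul, mul_assoc]

theorem applySnd_mem (x : A) : applySnd (haarFunctional h tr z) (comul x) ∈ baseL k A := by
  have h1 := D.strong_invariance' x 1
  have e : haarFunctional h tr z ∘ₗ LinearMap.mulRight k (anti k A 1) = haarFunctional h tr z := by
    ext a; simp [anti_one]
  rw [e] at h1
  rw [h1]
  exact applyFst_comul_one_mem _

omit [FiniteDimensional k A] in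
theorem apply_baseR {y : A} (hy : y ∈ baseR k A) :
    haarFunctional h tr z y = counit (R := k) y := D.apply_mul y hy

omit [FiniteDimensional k A] in
theorem dualPiR_eq : dualPiR (haarFunctional h tr z) = counit := by
  ext x
  rw [dualPiR_apply, D.apply_baseR (piR_mem x)]
  simpa using counit_piR_mul (k := k) x 1

/-- η is a right normalized left integral, and S exchanges sides, so η ∘ S is a left normalized
right integral; `dual_integral_eq` identifies them. -/
theorem apply_anti (x : A) : haarFunctional h tr z (anti k A x) = haarFunctional h tr z x := by
  have key : haarFunctional h tr z = haarFunctional h tr z ∘ₗ anti k A := by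
    refine dual_integral_eq (dual_left_integral D.applySnd_mem) D.dualPiR_eq
      (dual_right_integral fun x => ?_) ?_
    · apply mem_baseR_of_anti_mem D.inj
      have := D.applySnd_mem (anti k A x)
      rwa [comul_anti, antiTwist, LinearMap.comp_apply, LinearEquiv.coe_coe, applySnd_comm,
        applyFst_map] at this
    · ext x
      rw [dualPiL_apply, LinearMap.comp_apply, D.apply_baseR (anti_mem_baseR (piL_mem x)),
        counit_anti_of_mem_baseL (piL_mem x)]
      simpa using counit_mul_piL (k := k) 1 x
  exact (LinearMap.congr_fun key x).symm

theorem isHaarFunctional : IsHaarFunctional (haarFunctional h tr z) where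
  left_integral := dual_left_integral D.applySnd_mem
  right_integral := dual_right_integral fun x => by
    apply mem_baseR_of_anti_mem D.inj
    have := D.applySnd_mem (anti k A x)
    rw [comul_anti, antiTwist, LinearMap.comp_apply, LinearEquiv.coe_coe, applySnd_comm,
      applyFst_map] at this
    have e : haarFunctional h tr z ∘ₗ anti k A = haarFunctional h tr z :=
      LinearMap.ext D.apply_anti
    rwa [e] at this
  left_normalized := by
    ext x
    rw [dualPiL_apply, ← D.apply_anti, D.apply_baseR (anti_mem_baseR (piL_mem x)),
      counit_anti_of_mem_baseL (piL_mem x)]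
    simpa using counit_mul_piL (k := k) 1 x
  right_normalized := D.dualPiR_eq

/-- Both λ and the restriction of ε to A^R are S²-invariant, and z is determined by them. -/
theorem anti_anti_density_eq : anti k A (anti k A z) = z := by
  rw [← sub_eq_zero]
  have hz' : anti k A (anti k A z) ∈ baseR k A := anti_mem_baseR (anti_mem_baseL D.mem)
  refine D.nondegR _ (sub_mem hz' D.mem) fun y hy => ?_
  obtain ⟨w, hw, rfl⟩ := exists_anti_eq D.surj hy
  obtain ⟨y, rfl⟩ := D.surj w
  have hy' : y ∈ baseR k A := mem_baseR_of_anti_mem D.inj hw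
  rw [mul_sub, map_sub, D.apply_mul _ hy, ← anti_mul, ← anti_mul, D.dualIntegral_anti_anti,
    D.apply_mul _ hy', counit_anti_of_mem_baseL hw, counit_anti_of_mem_baseR hy', sub_self]

/-- By S-invariance, η(h₍₁₎) h₍₂₎ is the slice of c by η = tr(z d⁻¹ ·), namely d z d⁻¹; since S²(z)
= z, z commutes with d. -/
theorem hitRight_eq : hitRight h (haarFunctional h tr z) = z := by
  have e : haarFunctional h tr z = haarFunctional h tr z ∘ₗ anti k A :=
    LinearMap.ext fun x => (D.apply_anti x).symm
  have e2 : haarFunctional h tr z =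
      tr ∘ₗ LinearMap.mulLeft k (z * Ring.inverse (density h tr)) := by
    ext a
    simp only [haarFunctional_apply, IsTraceFrame.dualIntegral_apply, LinearMap.comp_apply,
      LinearMap.mulLeft_apply]
    rw [← mul_assoc, D.comm, mul_assoc]
  have h1 : hitRight h (haarFunctional h tr z) = applyFst (haarFunctional h tr z) (casimir k h) := by
    rw [hitRight, casimir, applyFst_map, ← e]; rfl
  have h2 := D.mul_density' z
  rw [D.anti_anti_density_eq] at h2
  rw [h1, e2, D.applyFst_casimir, ← mul_assoc, ← h2, mul_assoc, D.density_mul_inverse, mul_one]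

/-- `η(u₍₁₎ v) u₍₂₎ = η(u v₍₁₎) S(v₍₂₎)`. -/
theorem applyFst_mulRight (u v : A) :
    applyFst (haarFunctional h tr z ∘ₗ LinearMap.mulRight k v) (comul u) =
      anti k A (applyFst (haarFunctional h tr z ∘ₗ LinearMap.mulLeft k u) (comul v)) := by
  have h1 := D.strong_invariance' (anti k A v) u
  rw [comul_anti, antiTwist, LinearMap.comp_apply, LinearEquiv.coe_coe, applySnd_comm,
      applyFst_map] at h1
  have e1 : (haarFunctional h tr z ∘ₗ LinearMap.mulRight k (anti k A u)) ∘ₗ anti k A =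
      haarFunctional h tr z ∘ₗ LinearMap.mulLeft k u := by
    ext a
    simp only [LinearMap.comp_apply, LinearMap.mulRight_apply, LinearMap.mulLeft_apply]
    rw [← anti_mul, D.apply_anti]
  have e2 : haarFunctional h tr z ∘ₗ LinearMap.mulLeft k (anti k A v) ∘ₗ anti k A =
      haarFunctional h tr z ∘ₗ LinearMap.mulRight k v := by
    ext a
    simp only [LinearMap.comp_apply, LinearMap.mulRight_apply, LinearMap.mulLeft_apply]
    rw [← anti_mul, D.apply_anti]
  rw [e1, e2] at h1
  exact h1.symm

theorem anti_anti_of_trace (hz : IsUnit z)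
    (ht : ∀ x y, haarFunctional h tr z (x * y) = haarFunctional h tr z (y * x)) (x : A) :
    anti k A (anti k A x) = x := by
  have e (v : A) : haarFunctional h tr z ∘ₗ LinearMap.mulLeft k v =
      haarFunctional h tr z ∘ₗ LinearMap.mulRight k v := LinearMap.ext fun a => ht v a
  have h1 (u v : A) := D.applyFst_mulRight u v
  simp only [e] at h1
  obtain ⟨y, hy⟩ := D.exists_eq_trace (counit (R := k))
  -- Chosen so that η(· v) = ε. Traciality gives f(u, v) = S(f(v, u)) for f(u, v) = η(u₍₁₎ v) u₍₂₎,
  -- hence f = S² ∘ f, and f(x, v) = x.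
  let v := y * density h tr * Ring.inverse z
  have hv : haarFunctional h tr z ∘ₗ LinearMap.mulRight k v = counit := by
    rw [hy]
    ext a
    simp only [LinearMap.comp_apply, LinearMap.mulRight_apply, haarFunctional_apply,
      IsTraceFrame.dualIntegral_apply, v]
    rw [D.comm, mul_assoc, mul_assoc, mul_assoc, mul_assoc, ← mul_assoc (Ring.inverse z),
      Ring.inverse_mul_cancel _ hz, one_mul, D.density_mul_inverse, mul_one]
  have h2 := h1 x v
  rw [h1 v x, hv, applyFst_counit_comul] at h2
  exact h2.symm

omit [FiniteDimensional k A] in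
theorem mul'_comm_casimir_of_anti_anti (hS : ∀ x, anti k A (anti k A x) = x) :
    LinearMap.mul' k A (TensorProduct.comm k A A (casimir k h)) = 1 := by
  have e : anti k A ∘ₗ anti k A = LinearMap.id := LinearMap.ext hS
  have := D.casimir_symm
  rw [e, TensorProduct.map_id, LinearMap.id_apply] at this
  rw [← this, D.mul'_casimir]

omit [FiniteDimensional k A] in
theorem applyFst_comul_one : applyFst (haarFunctional h tr z) (comul 1) = 1 := by
  rw [← piL_of_mem (applyFst_comul_one_mem (k := k) (haarFunctional h tr z))]
  refine (piL_congr fun a => ?_).trans piL_one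
  rw [← dual_piR, D.apply_baseR (piR_mem a)]
  simpa using counit_piR_mul (k := k) a 1

-- It suffices that z is central, since η = tr(· z). The element w = tr(1₍₁₎) 1₍₂₎ is central and
-- inverse to S(z).
omit [FiniteDimensional k A] in
theorem trace_of_anti_anti (hS : ∀ x, anti k A (anti k A x) = x) (hd : density h tr = 1)
    (x y : A) : haarFunctional h tr z (x * y) = haarFunctional h tr z (y * x) := by
  let w := applyFst tr (comul (R := k) (1 : A))
  have hη : haarFunctional h tr z = tr ∘ₗ LinearMap.mulRight k z := by
    ext a; simp [haarFunctional_apply, IsTraceFrame.dualIntegral_apply, hd]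
  -- When S² = id, 1₍₁₎ ε(1₍₂₎ a) = S(Π^L(a)) = a₍₂₎ S(a₍₁₎), which has the same trace as S(a₍₁₎)
  -- a₍₂₎ = Π^R(a).
  have hbar (a : A) : tr (piR k a) = tr (piLBar k a) := by
    have h1 : piLBar k a = anti k A (piL k a) := by
      rw [← hS (piLBar k a), anti_of_mem_baseR (piLBar_mem a), piL_piLBar]
    rw [h1, ← piRHom_apply, ← piLHom_apply, piRHom, piLHom, conv_repr _ _ (ℛ k a),
      conv_repr _ _ (ℛ k a), map_sum, map_sum, map_sum]
    refine Finset.sum_congr rfl fun i _ => ?_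
    rw [D.comm, anti_mul, hS]; rfl
  have hw (a : A) : a * w = w * a := by
    rw [← applyFst_piLBar_comul tr (tr ∘ₗ piRHom k A)
      (fun a => by rw [LinearMap.comp_apply, piRHom_apply, hbar]) a]
    have := congrArg (applyFst tr) (map_piR_id_comul (k := k) a)
    rw [applyFst_map, applyFst_one_tmul_mul] at this
    exact this.symm
  have hwz : w * anti k A z = 1 := by
    rw [← D.applyFst_comul_one, hη, ← applyFst_mul_tmul_one, comul_one_mul_tmul_one D.mem,
      applyFst_mul_one_tmul]
  have hzw : anti k A z * w = 1 := by rw [hw, hwz]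
  have hSz (a : A) : a * anti k A z = anti k A z * a := by
    calc a * anti k A z = anti k A z * w * a * anti k A z := by rw [hzw, one_mul]
      _ = anti k A z * a * (w * anti k A z) := by rw [mul_assoc _ w a, ← hw]; simp only [mul_assoc]
      _ = anti k A z * a := by rw [hwz, mul_one]
  have hz (a : A) : a * z = z * a := D.inj (by rw [anti_mul, anti_mul, hSz])
  rw [hη]
  simp only [LinearMap.comp_apply, LinearMap.mulRight_apply]
  rw [mul_assoc, D.comm, mul_assoc, ← hz, mul_assoc]

end IsCounitDensity

/-! ### The density of the regular trace -/

namespace IsTraceFrame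

variable {h : A} {tr : Module.Dual k A} (F : IsTraceFrame h tr) [FiniteDimensional k A]
  (htr : ∀ a, tr a = LinearMap.trace k A (LinearMap.mulLeft k a))
include F

theorem sum_dualIntegral {ι : Type*} (r : Coalgebra.Repr k h ι) (x : A) :
    ∑ i ∈ r.index, dualIntegral h tr (x * anti k A (r.left i)) • r.right i = x := by
  have := F.applyFst_dualIntegral_comul x
  rw [← r.eq] at this
  simpa using this

theorem sum_dualIntegral' {ι : Type*} (r : Coalgebra.Repr k h ι) (x : A) :
    ∑ i ∈ r.index, dualIntegral h tr (r.right i * x) • anti k A (r.left i) = x := by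
  have := F.applySnd_dualIntegral_casimir x
  rw [casimir, ← r.eq] at this
  simpa using this

/-- Left and right multiplications have the same trace. -/
theorem trace_mulLeft (a : A) : LinearMap.trace k A (LinearMap.mulLeft k a) =
    LinearMap.trace k A (LinearMap.mulRight k a) := by
  -- The legs of c give dual bases with respect to λ; in them both traces become λ(h₍₂₎ a S(h₍₁₎)).
  let r := ℛ k h
  have h1 : LinearMap.mulLeft k a = ∑ i ∈ r.index, LinearMap.smulRight
      (dualIntegral h tr ∘ₗ LinearMap.mulLeft k (r.right i)) (a * anti k A (r.left i)) := by
    ext x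
    conv_lhs => rw [← F.sum_dualIntegral' r x]
    simp
  have h2 : LinearMap.mulRight k a = ∑ i ∈ r.index, LinearMap.smulRight
      (dualIntegral h tr ∘ₗ LinearMap.mulRight k (a * anti k A (r.left i))) (r.right i) := by
    ext x
    conv_lhs => rw [LinearMap.mulRight_apply, ← F.sum_dualIntegral r (x * a)]
    simp [mul_assoc]
  rw [h1, h2]
  simp [mul_assoc]

include htr

theorem trace_anti (a : A) : tr (anti k A a) = tr a := by
  let S := LinearEquiv.ofBijective (anti k A) ⟨F.inj, F.surj⟩
  rw [htr, htr, F.trace_mulLeft a, ← LinearMap.trace_conj' (LinearMap.mulRight k a) S]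
  congr 1
  ext x
  obtain ⟨y, rfl⟩ := S.surjective x
  rw [LinearEquiv.conj_apply_apply, LinearEquiv.symm_apply_apply]
  exact (anti_mul y a).symm

/-- Computing the regular trace in the dual bases gives tr(a) = λ(a q) with q = h₍₂₎ S(h₍₁₎).
Nondegeneracy of tr then forces q d⁻¹ = 1. -/
theorem density_eq_mul'_comm :
    density h tr = LinearMap.mul' k A (TensorProduct.comm k A A (casimir k h)) := by
  let r := ℛ k h
  set q := LinearMap.mul' k A (TensorProduct.comm k A A (casimir k h)) with hq
  have hq' : q = ∑ i ∈ r.index, r.right i * anti k A (r.left i) := by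
    rw [hq, casimir, ← r.eq]
    simp
  have h1 (a : A) : LinearMap.mulLeft k a = ∑ i ∈ r.index, LinearMap.smulRight
      (dualIntegral h tr ∘ₗ LinearMap.mulRight k (anti k A (r.left i))) (a * r.right i) := by
    ext x
    conv_lhs => rw [← F.sum_dualIntegral r x]
    simp
  have h2 (a : A) : tr a = dualIntegral h tr (a * q) := by
    rw [htr, h1, hq']
    simp [Finset.mul_sum, mul_assoc]
  have h3 : 1 - q * Ring.inverse (density h tr) = 0 := by
    refine F.nondeg _ fun a => ?_
    rw [sub_mul, one_mul, map_sub, h2 a, IsTraceFrame.dualIntegral_apply, F.comm, mul_assoc,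
      F.comm a, sub_self]
  rw [sub_eq_zero] at h3
  rw [← one_mul (density h tr), h3, mul_assoc, F.inverse_mul_density, mul_one]

theorem trace_density : tr (density h tr) = tr 1 := by
  rw [F.density_eq_mul'_comm htr, ← F.mul'_casimir]
  generalize casimir k h = s
  induction s using TensorProduct.induction_on with
  | zero => simp
  | tmul a b => simp [F.comm b a]
  | add s t hs ht => simp only [map_add, hs, ht]

/-- `d = tr(h₍₁₎) h₍₂₎`. -/
theorem density_eq_applyFst : density h tr = applyFst tr (comul h) := by
  have h1 := F.applyFst_casimir 1
  have e : tr ∘ₗ anti k A = tr := LinearMap.ext (F.trace_anti htr)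
  rw [LinearMap.mulLeft_one, LinearMap.comp_id, casimir, applyFst_map, e, mul_one] at h1
  exact h1.symm

end IsTraceFrame

end WeakHopfAlgebra

open scoped ComplexOrder

/-! ### Positivity of the regular trace on a C⋆-algebra -/

section RegularTrace

variable {A : Type*} [CStarAlgebra A] [FiniteDimensional ℂ A]

variable (A) in
/-- The trace of the left regular representation. -/
def regularTrace : Module.Dual ℂ A :=
  LinearMap.trace ℂ A ∘ₗ (Algebra.lmul ℂ A).toLinearMap

omit [FiniteDimensional ℂ A] in
theorem regularTrace_apply (a : A) :
    regularTrace A a = LinearMap.trace ℂ A (LinearMap.mulLeft ℂ a) := rfl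

theorem regularTrace_one : regularTrace A 1 = Module.finrank ℂ A := by
  rw [regularTrace_apply, LinearMap.mulLeft_one]
  exact LinearMap.trace_id ℂ A

omit [FiniteDimensional ℂ A] in
theorem regularTrace_mul_comm (a b : A) : regularTrace A (a * b) = regularTrace A (b * a) := by
  simp only [regularTrace_apply, LinearMap.mulLeft_mul]
  exact LinearMap.trace_mul_comm ℂ _ _

/-- Makes tr(a) a sum of spectral values of a, so reality, positivity and faithfulness of tr follow
from C⋆-spectral theory. -/
theorem hasEigenvalue_mulLeft_iff (a : A) (μ : ℂ) :
    Module.End.HasEigenvalue (LinearMap.mulLeft ℂ a : Module.End ℂ A) μ ↔ μ ∈ spectrum ℂ a := by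
  rw [Module.End.hasEigenvalue_iff_mem_spectrum, spectrum.mem_iff, spectrum.mem_iff, not_iff_not]
  have e : algebraMap ℂ (Module.End ℂ A) μ - LinearMap.mulLeft ℂ a =
      LinearMap.mulLeft ℂ (algebraMap ℂ A μ - a) := by
    ext x; simp [sub_mul, Algebra.smul_def]
  rw [e]
  constructor
  · intro h
    rw [Module.End.isUnit_iff] at h
    obtain ⟨y, hy⟩ := h.2 1
    have hy' : (algebraMap ℂ A μ - a) * y = 1 := hy
    refine ⟨⟨_, y, hy', h.1 ?_⟩, rfl⟩
    simp only [LinearMap.mulLeft_apply]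
    rw [← mul_assoc, hy', one_mul, mul_one]
  · exact fun h => h.map (Algebra.lmul ℂ A)

theorem regularTrace_eq_sum (a : A) : regularTrace A a =
    (LinearMap.charpoly (LinearMap.mulLeft ℂ a)).roots.sum :=
  Module.End.trace_eq_sum_roots_charpoly_of_splits (IsAlgClosed.splits _)

theorem mem_roots_iff (a : A) (μ : ℂ) :
    μ ∈ (LinearMap.charpoly (LinearMap.mulLeft ℂ a)).roots ↔ μ ∈ spectrum ℂ a := by
  rw [← hasEigenvalue_mulLeft_iff, Module.End.hasEigenvalue_iff_isRoot_charpoly,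
    Polynomial.mem_roots (LinearMap.charpoly_monic _).ne_zero]

theorem regularTrace_star (a : A) : regularTrace A (star a) = star (regularTrace A a) := by
  have hsa : ∀ a : A, IsSelfAdjoint a → star (regularTrace A a) = regularTrace A a := by
    intro a ha
    rw [regularTrace_eq_sum]
    have : ∀ s : Multiset ℂ, (∀ μ ∈ s, star μ = μ) → star s.sum = s.sum := by
      intro s
      induction s using Multiset.induction_on with
      | empty => simp
      | cons μ s ih =>
        intro h
        rw [Multiset.sum_cons, star_add, h μ (Multiset.mem_cons_self _ _),
          ih fun ν hν => h ν (Multiset.mem_cons_of_mem hν)]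
    refine this _ fun μ hμ => ?_
    rw [mem_roots_iff] at hμ
    exact Complex.conj_eq_iff_re.mpr (ha.mem_spectrum_eq_re hμ).symm
  have h1 := realPart_add_I_smul_imaginaryPart a
  have e1 := hsa _ (realPart a).2
  have e2 := hsa _ (imaginaryPart a).2
  have f1 : star (realPart a : A) = realPart a := (realPart a).2
  have f2 : star (imaginaryPart a : A) = imaginaryPart a := (imaginaryPart a).2
  rw [← h1, star_add, star_smul, map_add, map_add, star_add, map_smul, map_smul, star_smul, f1, f2,
    e1, e2]

variable [PartialOrder A] [StarOrderedRing A]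

theorem regularTrace_nonneg {a : A} (ha : 0 ≤ a) : 0 ≤ regularTrace A a := by
  rw [regularTrace_eq_sum]
  refine Multiset.sum_nonneg fun μ hμ => ?_
  rw [mem_roots_iff] at hμ
  exact spectrum_nonneg_of_nonneg ha hμ

theorem eq_zero_of_regularTrace_eq_zero {a : A} (ha : 0 ≤ a) (h : regularTrace A a = 0) :
    a = 0 := by
  have ha' : IsStarNormal a := (IsSelfAdjoint.of_nonneg ha).isStarNormal
  refine CFC.eq_zero_of_spectrum_subset_zero (R := ℂ) a fun μ hμ => ?_
  rw [regularTrace_eq_sum] at h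
  have hnn : ∀ ν ∈ (LinearMap.charpoly (LinearMap.mulLeft ℂ a)).roots, 0 ≤ ν := fun ν hν =>
    spectrum_nonneg_of_nonneg ha ((mem_roots_iff a ν).mp hν)
  have hμ' := (mem_roots_iff a μ).mpr hμ
  have := Multiset.single_le_sum hnn μ hμ'
  rw [h] at this
  exact le_antisymm this (hnn μ hμ')

theorem eq_zero_of_regularTrace_star_mul_self {x : A} (h : regularTrace A (star x * x) = 0) :
    x = 0 :=
  CStarRing.star_mul_self_eq_zero_iff x |>.mp
    (eq_zero_of_regularTrace_eq_zero (star_mul_self_nonneg x) h)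

theorem regularTrace_nondegenerate (x : A) (h : ∀ y, regularTrace A (x * y) = 0) : x = 0 :=
  eq_zero_of_regularTrace_star_mul_self (by rw [regularTrace_mul_comm]; exact h _)

variable (A) in
/-- The inner product `⟪x, y⟫ = tr(x⋆ y)`. -/
abbrev regularTraceCore : InnerProductSpace.Core ℂ A where
  inner x y := regularTrace A (star x * y)
  conj_inner_symm x y := by
    change star (regularTrace A (star y * x)) = _
    rw [← regularTrace_star, star_mul, star_star]
  re_inner_nonneg x := (Complex.le_def.mp (regularTrace_nonneg (star_mul_self_nonneg x))).1
  add_left x y z := by rw [star_add, add_mul, map_add]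
  smul_left x y r := by rw [star_smul, smul_mul_assoc, map_smul]; rfl
  definite x h := eq_zero_of_regularTrace_star_mul_self h

theorem exists_orthogonal_projection (N : Submodule ℂ A) (x : A) :
    ∃ p ∈ N, ∀ w ∈ N, regularTrace A (star w * (x - p)) = 0 := by
  -- Stated for a bare vector space, so that the norm induced by the inner product does not clash
  -- with the C⋆-norm of A.
  have key : ∀ {V : Type _} [AddCommGroup V] [Module ℂ V] [FiniteDimensional ℂ V]
      (c : InnerProductSpace.Core ℂ V) (N : Submodule ℂ V) (x : V),
      ∃ p ∈ N, ∀ w ∈ N, c.inner w (x - p) = 0 := by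
    intro V _ _ _ c N x
    let := c.toNormedAddCommGroup
    let : InnerProductSpace ℂ V := InnerProductSpace.ofCore c.toCore
    exact ⟨N.starProjection x, N.starProjection_apply_mem x, fun w hw =>
      N.sub_starProjection_mem_orthogonal x w hw⟩
  exact key (regularTraceCore A) N x

theorem exists_orthonormal_basis : ∃ b : Module.Basis (Fin (Module.finrank ℂ A)) ℂ A,
    ∀ i j, regularTrace A (star (b i) * b j) = if i = j then 1 else 0 := by
  have key : ∀ {V : Type _} [AddCommGroup V] [Module ℂ V] [FiniteDimensional ℂ V]
      (c : InnerProductSpace.Core ℂ V), ∃ b : Module.Basis (Fin (Module.finrank ℂ V)) ℂ V,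
      ∀ i j, c.inner (b i) (b j) = if i = j then 1 else 0 := by
    intro V _ _ _ c
    let := c.toNormedAddCommGroup
    let : InnerProductSpace ℂ V := InnerProductSpace.ofCore c.toCore
    refine ⟨(stdOrthonormalBasis ℂ V).toBasis, fun i j => ?_⟩
    have := orthonormal_iff_ite.mp (stdOrthonormalBasis ℂ V).orthonormal i j
    simpa using this
  exact key (regularTraceCore A)

/-- The partial trace of `T⋆ T` is positive. -/
theorem applyFst_regularTrace_nonneg (t : A ⊗[ℂ] A) :
    0 ≤ applyFst (regularTrace A) (star t * t) := by
  obtain ⟨b, hb⟩ := exists_orthonormal_basis (A := A)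
  obtain ⟨c, rfl⟩ := TensorProduct.eq_repr_basis_left b t
  rw [Finsupp.sum_fintype _ _ (by simp)]
  have e : applyFst (regularTrace A) (star (∑ i, b i ⊗ₜ[ℂ] c i) * ∑ i, b i ⊗ₜ[ℂ] c i) =
      ∑ i, star (c i) * c i := by
    simp [star_sum, Finset.sum_mul_sum, hb]
  rw [e]
  exact Finset.sum_nonneg fun i _ => star_mul_self_nonneg _

end RegularTrace

/-! ### The involution, and existence of the Haar integral -/

namespace CStarWeakHopfAlgebra

open Coalgebra TensorProduct WeakHopfAlgebra
open scoped ComplexOrder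

variable {A : Type*} [CStarAlgebra A]

/-- The functional `x ↦ conj φ(x⋆)`. -/
def dualStar (φ : Module.Dual ℂ A) : Module.Dual ℂ A where
  toFun x := star (φ (star x))
  map_add' x y := by simp
  map_smul' c x := by simp

theorem dualStar_apply (φ : Module.Dual ℂ A) (x : A) : dualStar φ x = star (φ (star x)) := rfl

theorem star_applyFst (φ : Module.Dual ℂ A) (t : A ⊗[ℂ] A) :
    star (applyFst φ t) = applyFst (dualStar φ) (star t) := by
  induction t using TensorProduct.induction_on with
  | zero => simp
  | tmul a b => simp [dualStar_apply]
  | add s t hs ht => simp [hs, ht]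

theorem star_applySnd (φ : Module.Dual ℂ A) (t : A ⊗[ℂ] A) :
    star (applySnd φ t) = applySnd (dualStar φ) (star t) := by
  induction t using TensorProduct.induction_on with
  | zero => simp
  | tmul a b => simp [dualStar_apply]
  | add s t hs ht => simp [hs, ht]

variable [CStarWeakHopfAlgebra A]

theorem star_comul_one : star (comul (R := ℂ) (1 : A)) = comul 1 := by
  rw [← comul_star, star_one]

/-- The functional x ↦ conj ε(x⋆) is again a left counit because Δ preserves ⋆, and counits are
unique. -/
theorem counit_star (x : A) : counit (R := ℂ) (star x) = star (counit (R := ℂ) x) := by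
  have h1 (x : A) : applyFst (dualStar (counit (R := ℂ))) (comul x) = x := by
    have := star_applyFst (counit (R := ℂ)) (comul (star x))
    rw [applyFst_counit_comul, star_star, comul_star, star_star] at this
    exact this.symm
  have h2 := congrArg (counit (R := ℂ)) (h1 x)
  rw [apply_applyFst, ← apply_applySnd, applySnd_counit_comul, dualStar_apply] at h2
  rw [← h2, star_star]

theorem star_mem_baseR {y : A} (hy : y ∈ baseR ℂ A) : star y ∈ baseR ℂ A := by
  rw [mem_baseR, comul_star]
  refine ⟨?_, ?_⟩
  · rw [hy.2, star_mul, star_comul_one, star_tmul, star_one]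
  · rw [hy.1, star_mul, star_comul_one, star_tmul, star_one]

theorem star_piL_star (x : A) : star (piL ℂ (star x)) = piRBar ℂ x := by
  rw [piL, star_applyFst, star_comul_one, piRBar]
  congr 2
  ext a
  simp [dualStar_apply, ← star_mul, counit_star]

theorem star_piR_star (x : A) : star (piR ℂ (star x)) = piLBar ℂ x := by
  rw [piR, star_applySnd, star_comul_one, piLBar]
  congr 2
  ext a
  simp [dualStar_apply, ← star_mul, counit_star]

variable (A) in
/-- `x ↦ S(x⋆)⋆`. -/
def antiStar : A →ₗ[ℂ] A where
  toFun x := star (anti ℂ A (star x))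
  map_add' x y := by simp
  map_smul' c x := by simp

theorem antiStar_apply (x : A) : antiStar A x = star (anti ℂ A (star x)) := rfl

/-- `(f(x⋆₍₁₎) g(x⋆₍₂₎))⋆` in terms of the coproduct of `x`. -/
theorem star_conv_star (f g : A →ₗ[ℂ] A) (x : A) {ι : Type*} (r : Coalgebra.Repr ℂ x ι) :
    star (conv f g (star x)) =
      ∑ i ∈ r.index, star (g (star (r.right i))) * star (f (star (r.left i))) := by
  rw [conv_apply, comul_star, ← r.eq]
  simp [star_sum]

/-- For T(x) = S(S(x⋆)⋆), S * T = Π^R and Π^L * T = T, so T = id * S * T = id * S * id = id. This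
supplies bijectivity of S, which is not an axiom. -/
theorem anti_comp_antiStar : anti ℂ A ∘ₗ antiStar A = LinearMap.id := by
  have h1 : conv (anti ℂ A) (anti ℂ A ∘ₗ antiStar A) = piRHom ℂ A := by
    ext x
    have e := star_piL_star x
    rw [← piLHom_apply, piLHom, star_conv_star _ _ x (ℛ ℂ x)] at e
    rw [piRHom_apply, ← piR_piRBar, ← anti_of_mem_baseL (piRBar_mem x), ← e,
      conv_repr _ _ (ℛ ℂ x), map_sum]
    refine Finset.sum_congr rfl fun i _ => ?_
    rw [anti_mul, LinearMap.id_apply, star_star]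
    rfl
  have h2 : conv (piLHom ℂ A) (anti ℂ A ∘ₗ antiStar A) = anti ℂ A ∘ₗ antiStar A := by
    ext x
    have e : antiStar A x = star (conv (piRHom ℂ A) (anti ℂ A) (star x)) := by
      rw [conv_piRHom_anti, antiStar_apply]
    rw [LinearMap.comp_apply, e, star_conv_star _ _ x (ℛ ℂ x), conv_repr _ _ (ℛ ℂ x), map_sum]
    refine Finset.sum_congr rfl fun i _ => ?_
    rw [anti_mul, piRHom_apply, star_piR_star, anti_of_mem_baseR (piLBar_mem _), piL_piLBar,
      piLHom_apply]
    rfl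
  rw [← h2, piLHom, conv_assoc, h1, piRHom, ← conv_assoc, ← piLHom, conv_piLHom_id]

theorem anti_star_anti_star (x : A) : anti ℂ A (star (anti ℂ A (star x))) = x :=
  LinearMap.congr_fun anti_comp_antiStar x

theorem anti_surjective : Function.Surjective (anti ℂ A) := fun x => ⟨_, anti_star_anti_star x⟩

theorem anti_injective : Function.Injective (anti ℂ A) := fun x y h => by
  have hx := anti_star_anti_star (star x)
  have hy := anti_star_anti_star (star y)
  rw [star_star] at hx hy
  rw [h, hy] at hx
  exact (star_injective hx).symm

variable [FiniteDimensional ℂ A] [PartialOrder A] [StarOrderedRing A]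

-- Let q be the orthogonal projection of 1 to the left ideal N of all x with ε(ax) = 0 for every a.
-- Then p = 1 − q is a self-adjoint idempotent with Np = 0. Since x − Π^L(x) lies in N, p is a left
-- integral; since q lies in N, it is normalized; the right-hand properties follow by ⋆.
variable (A) in
theorem exists_haarIntegral :
    ∃ h : A, IsHaarIntegral ℂ h ∧ star h = h ∧ h * h = h := by
  let N : Submodule ℂ A :=
    { carrier := {x | ∀ a, counit (R := ℂ) (a * x) = 0}
      add_mem' := fun hx hy a => by rw [mul_add, map_add, hx, hy, add_zero]
      zero_mem' := fun a => by rw [mul_zero, map_zero]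
      smul_mem' := fun c x hx a => by rw [mul_smul_comm, map_smul, hx, smul_zero] }
  have hNmul : ∀ {x : A}, x ∈ N → ∀ b, b * x ∈ N := fun hx b a => by
    rw [← mul_assoc]; exact hx _
  obtain ⟨q, hqN, hq⟩ := exists_orthogonal_projection N (1 : A)
  set p := 1 - q with hp
  have hqp : q = 1 - p := by rw [hp]; abel
  have hNp : ∀ {x : A}, x ∈ N → x * p = 0 := fun {x} hx => by
    have hxp : x * p ∈ N := by
      rw [hp, mul_sub, mul_one]
      exact sub_mem hx (hNmul hqN x)
    apply eq_zero_of_regularTrace_star_mul_self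
    have := hq (star x * (x * p)) (hNmul hxp _)
    rwa [star_mul, star_star, mul_assoc] at this
  have hpp : p * p = p := by
    have := hNp hqN
    rw [hqp, sub_mul, one_mul, sub_eq_zero] at this
    exact this.symm
  have hps : star p = p := by
    have h1 : p * star q = 0 := by
      refine regularTrace_nondegenerate _ fun a => ?_
      have := hq (star a * q) (hNmul hqN _)
      rw [star_mul, star_star] at this
      rwa [mul_assoc, regularTrace_mul_comm]
    rw [hqp, star_sub, star_one, mul_sub, mul_one, sub_eq_zero] at h1
    have h2 := congrArg star h1
    rw [star_mul, star_star, ← h1] at h2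
    exact h2
  have hpN : ∀ {x : A}, (∀ a, counit (R := ℂ) (x * a) = 0) → p * x = 0 := fun {x} hx => by
    have h1 : star x ∈ N := fun a => by
      rw [← star_star a, ← star_mul, counit_star, hx, star_zero]
    have := congrArg star (hNp h1)
    rwa [star_mul, star_star, hps, star_zero] at this
  have hqs : star q = q := by rw [hqp, star_sub, star_one, hps]
  refine ⟨p, ⟨fun x => ?_, fun x => ?_, ?_, ?_⟩, hps, hpp⟩
  · rw [← sub_eq_zero, ← sub_mul]
    exact hNp fun a => by rw [mul_sub, map_sub, counit_mul_piL, sub_self]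
  · rw [← sub_eq_zero, ← mul_sub]
    exact hpN fun a => by rw [sub_mul, map_sub, counit_piR_mul, sub_self]
  · rw [← piL_one (k := ℂ)]
    exact piL_congr fun a => by rw [hp, mul_sub, map_sub, hqN a, sub_zero]
  · rw [← piR_one (k := ℂ)]
    refine piR_congr fun a => ?_
    have : counit (R := ℂ) (q * a) = 0 := by
      rw [← star_star (q * a), counit_star, star_mul, hqs, hqN, star_zero]
    rw [hp, sub_mul, map_sub, this, sub_zero]

end CStarWeakHopfAlgebra

/-! ### Positivity of d and z -/

namespace CStarWeakHopfAlgebra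

open Coalgebra TensorProduct WeakHopfAlgebra
open scoped ComplexOrder

variable {A : Type*} [CStarAlgebra A] [CStarWeakHopfAlgebra A] [FiniteDimensional ℂ A]

theorem exists_inverse_mem_baseR {c : A} (hc : c ∈ baseR ℂ A)
    (hinj : ∀ y ∈ baseR ℂ A, c * y = 0 → y = 0) : ∃ w ∈ baseR ℂ A, c * w = 1 ∧ w * c = 1 := by
  let L : baseR ℂ A →ₗ[ℂ] baseR ℂ A := LinearMap.mulLeft ℂ ⟨c, hc⟩
  have hL : Function.Injective L := by
    rw [injective_iff_map_eq_zero]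
    exact fun y hy => Subtype.ext (hinj y y.2 (congrArg Subtype.val hy))
  obtain ⟨w, hw⟩ := LinearMap.injective_iff_surjective.mp hL 1
  have hw' : c * (w : A) = 1 := congrArg Subtype.val hw
  refine ⟨w, w.2, hw', ?_⟩
  rw [← sub_eq_zero]
  refine hinj _ (sub_mem (mul_mem w.2 hc) (one_mem _)) ?_
  rw [mul_sub, ← mul_assoc, hw', one_mul, mul_one, sub_self]

variable [PartialOrder A] [StarOrderedRing A]

theorem isTraceFrame {h : A} (hh : IsHaarIntegral ℂ h) : IsTraceFrame h (regularTrace A) where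
  haar := hh
  surj := anti_surjective
  inj := anti_injective
  comm := regularTrace_mul_comm
  nondeg := regularTrace_nondegenerate

variable {h : A} (hh : IsHaarIntegral ℂ h)
include hh

theorem star_haarIntegral : star h = h ∧ h * h = h := by
  obtain ⟨h', hh', hs, hi⟩ := exists_haarIntegral A
  rw [hh.eq hh']
  exact ⟨hs, hi⟩

/-- As h is a projection, d = tr(h₍₁₎) h₍₂₎ is the partial trace of Δ(h)⋆Δ(h). -/
theorem isStrictlyPositive_density : IsStrictlyPositive (density h (regularTrace A)) := by
  refine (isTraceFrame hh).isUnit_density.isStrictlyPositive ?_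
  obtain ⟨hs, hi⟩ := star_haarIntegral hh
  have e : comul (R := ℂ) h = star (comul h) * comul h := by
    rw [← comul_star, hs, ← comul_mul, hi]
  rw [(isTraceFrame hh).density_eq_applyFst regularTrace_apply, e]
  exact applyFst_regularTrace_nonneg _

/-- A self-adjoint square root of the density and its inverse. -/
theorem exists_sqrt_density : ∃ s t : A, star s = s ∧ star t = t ∧ s * t = 1 ∧ t * s = 1 ∧
    density h (regularTrace A) = s * s ∧ Ring.inverse (density h (regularTrace A)) = t * t := by
  obtain ⟨s, hsu, hss, hs⟩ :=
    CStarAlgebra.isStrictlyPositive_iff_exists_isUnit_and_isSelfAdjoint_and_eq_mul_self.mp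
      (isStrictlyPositive_density hh)
  refine ⟨s, Ring.inverse s, hss, ?_, Ring.mul_inverse_cancel s hsu, Ring.inverse_mul_cancel s hsu,
    hs, ?_⟩
  · rw [← Ring.inverse_star, hss.star_eq]
  · rw [hs, ← pow_two, ← pow_two, Ring.inverse_pow]

local notation "Λ" => dualIntegral h (regularTrace A)

theorem dualIntegral_star (x : A) : Λ (star x) = star (Λ x) := by
  obtain ⟨s, t, hs, ht, -, -, -, he⟩ := exists_sqrt_density hh
  rw [IsTraceFrame.dualIntegral_apply, IsTraceFrame.dualIntegral_apply, ← regularTrace_star,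
    star_mul, he, star_mul, ht, regularTrace_mul_comm]

theorem dualIntegral_star_mul_self (a : A) :
    ∃ b : A, Λ (star a * a) = regularTrace A (star b * b) ∧ (b = 0 → a = 0) := by
  obtain ⟨s, t, hs, ht, -, hts, -, he⟩ := exists_sqrt_density hh
  refine ⟨a * t, ?_, fun h0 => ?_⟩
  · rw [IsTraceFrame.dualIntegral_apply, he, star_mul, ht, mul_assoc, regularTrace_mul_comm]
    simp only [mul_assoc]
  · rw [← mul_one a, ← hts, ← mul_assoc, h0, zero_mul]

theorem dualIntegral_star_mul_self_nonneg (a : A) : 0 ≤ Λ (star a * a) := by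
  obtain ⟨b, hb, -⟩ := dualIntegral_star_mul_self hh a
  rw [hb]
  exact regularTrace_nonneg (star_mul_self_nonneg b)

theorem eq_zero_of_dualIntegral {a : A} (ha : Λ (star a * a) = 0) : a = 0 := by
  obtain ⟨b, hb, hab⟩ := dualIntegral_star_mul_self hh a
  rw [hb] at ha
  exact hab (eq_zero_of_regularTrace_star_mul_self ha)

/-- λ is faithful and positive and A^R is closed under ⋆, so the form λ(ya) on A^R is nondegenerate
and represents ε. -/
theorem exists_isCounitDensity : ∃ z, IsCounitDensity h (regularTrace A) z := by
  let T : baseR ℂ A →ₗ[ℂ] Module.Dual ℂ (baseR ℂ A) :=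
    (LinearMap.mul ℂ (baseR ℂ A)).flip.compr₂ (Λ ∘ₗ (baseR ℂ A).val.toLinearMap)
  have hnd : ∀ a ∈ baseR ℂ A, (∀ y ∈ baseR ℂ A, Λ (y * a) = 0) → a = 0 := fun a ha h0 =>
    eq_zero_of_dualIntegral hh (h0 _ (star_mem_baseR ha))
  have hT : Function.Injective T := by
    rw [injective_iff_map_eq_zero]
    exact fun a ha => Subtype.ext (hnd a a.2 fun y hy => LinearMap.congr_fun ha ⟨y, hy⟩)
  obtain ⟨z, hz⟩ := (LinearMap.injective_iff_surjective_of_finrank_eq_finrank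
    (Subspace.dual_finrank_eq (K := ℂ) (V := baseR ℂ A)).symm).mp hT
      (counit ∘ₗ (baseR ℂ A).val.toLinearMap)
  exact ⟨z, isTraceFrame hh, z.2, fun y hy => LinearMap.congr_fun hz ⟨y, hy⟩, hnd⟩

omit hh in
theorem star_counitDensity {z : A} (D : IsCounitDensity h (regularTrace A) z) : star z = z := by
  rw [← sub_eq_zero]
  refine D.nondegR _ (sub_mem (star_mem_baseR D.mem) D.mem) fun y hy => ?_
  have h1 : Λ (y * star z) = counit (R := ℂ) y := by
    rw [← star_star (y * star z), dualIntegral_star D.haar, star_mul, star_star, D.dualIntegral_mul,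
      D.anti_anti_density_eq, D.apply_mul _ (star_mem_baseR hy), counit_star, star_star]
  rw [mul_sub, map_sub, h1, D.apply_mul y hy, sub_self]

-- Both sides equal ε(y S²(y⋆)): the left by the defining property of z, the right by `counit_baseR`
-- and h = h⋆h.
omit hh in
theorem dualIntegral_conj {z : A} (D : IsCounitDensity h (regularTrace A) z) {y : A}
    (hy : y ∈ baseR ℂ A) : Λ (star y * z * y) = Λ (star (h * y) * (h * y)) := by
  obtain ⟨hs, hi⟩ := star_haarIntegral D.haar
  have hw : y * anti ℂ A (anti ℂ A (star y)) ∈ baseR ℂ A :=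
    mul_mem hy (anti_mem_baseR (anti_mem_baseL (star_mem_baseR hy)))
  have h1 : Λ (star y * z * y) = counit (R := ℂ) (y * anti ℂ A (anti ℂ A (star y))) := by
    rw [mul_assoc, D.dualIntegral_mul, mul_assoc, D.dualIntegral_mul z, D.anti_anti_density_eq,
      D.apply_mul _ hw]
  have h2 : star (h * y) * (h * y) = star y * h * y := by
    rw [star_mul, hs, mul_assoc, ← mul_assoc h h, hi, mul_assoc]
  rw [h1, h2, mul_assoc, D.dualIntegral_mul (star y), mul_assoc, D.dualIntegral_mul h, D.anti_haar,
    D.anti_haar, D.counit_baseR hw]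

-- If hy = 0 then y⋆h = 0, and S(y⋆) = Π^L(y⋆) = Π^L(y⋆ Π^L(h)) = Π^L(y⋆h) = 0.
omit hh in
theorem eq_zero_of_haarIntegral_mul {z : A} (D : IsCounitDensity h (regularTrace A) z) {y : A}
    (hy : y ∈ baseR ℂ A) (h0 : h * y = 0) : y = 0 := by
  have h1 : star y * h = 0 := by
    have := congrArg star h0
    rwa [star_mul, (star_haarIntegral D.haar).1, star_zero] at this
  have h2 : anti ℂ A (star y) = 0 := by
    rw [anti_of_mem_baseR (star_mem_baseR hy), ← mul_one (star y), ← D.haar.left_normalized,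
      piL_mul_piL, h1, ← piLHom_apply, map_zero]
  have h3 : star y = 0 := anti_injective (by rw [h2, map_zero])
  rwa [star_eq_zero] at h3

omit hh in
/-- A real `μ ≤ 0` is a regular value of `z`, with resolvent in `A^R`. -/
theorem exists_resolvent {z : A} (D : IsCounitDensity h (regularTrace A) z) {μ : ℝ} (hμ : μ ≤ 0) :
    ∃ w ∈ baseR ℂ A, (z - (μ : ℂ) • 1) * w = 1 ∧ w * (z - (μ : ℂ) • 1) = 1 := by
  refine exists_inverse_mem_baseR
    (sub_mem D.mem (Subalgebra.smul_mem _ (one_mem _) _)) fun y hy h0 => ?_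
  -- If zy = μy, then μ λ(y⋆y) = λ((hy)⋆(hy)): the left side is at most 0 and the right side at
  -- least 0, so hy = 0.
  rw [sub_mul, smul_mul_assoc, one_mul, sub_eq_zero] at h0
  have h1 := dualIntegral_conj D hy
  rw [mul_assoc, h0, mul_smul_comm, map_smul, smul_eq_mul] at h1
  have h2 := dualIntegral_star_mul_self_nonneg D.haar y
  have h3 := dualIntegral_star_mul_self_nonneg D.haar (h * y)
  have h4 : (μ : ℂ) * Λ (star y * y) ≤ 0 :=
    mul_nonpos_of_nonpos_of_nonneg (by exact_mod_cast hμ) h2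
  rw [h1] at h4
  exact eq_zero_of_haarIntegral_mul D hy (eq_zero_of_dualIntegral D.haar (le_antisymm h4 h3))

omit hh in
theorem isStrictlyPositive_counitDensity {z : A} (D : IsCounitDensity h (regularTrace A) z) :
    IsStrictlyPositive z := by
  have hz : IsSelfAdjoint z := star_counitDensity D
  rw [StarOrderedRing.isStrictlyPositive_iff_spectrum_pos (R := ℝ) z]
  intro μ hμ
  by_contra hneg
  obtain ⟨w, -, h1, h2⟩ := exists_resolvent D (not_lt.mp hneg)
  rw [spectrum.mem_iff] at hμ
  apply hμ
  have e : algebraMap ℝ A μ - z = -(z - (μ : ℂ) • 1) := by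
    rw [Algebra.algebraMap_eq_smul_one, neg_sub, Complex.coe_smul]
  rw [e]
  exact IsUnit.neg ⟨⟨_, w, h1, h2⟩, rfl⟩

-- The case μ = 0 of the resolvent places z⁻¹ in A^R, so ε(z⁻¹) = λ(z⁻¹ z) = λ(1).
omit hh in
theorem counit_inverse {z : A} (D : IsCounitDensity h (regularTrace A) z) :
    counit (R := ℂ) (Ring.inverse z) =
      regularTrace A (Ring.inverse (density h (regularTrace A))) := by
  obtain ⟨w, hw, h1, h2⟩ := exists_resolvent D le_rfl
  rw [Complex.ofReal_zero, zero_smul, sub_zero] at h1 h2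
  have e : Ring.inverse z = w := Ring.inverse_unit ⟨z, w, h1, h2⟩
  rw [e, ← D.apply_mul w hw, h2, IsTraceFrame.dualIntegral_apply, mul_one]

theorem density_eq_one (htr : regularTrace A (Ring.inverse (density h (regularTrace A))) =
    regularTrace A 1) : density h (regularTrace A) = 1 := by
  obtain ⟨s, t, hs, ht, hst, hts, hd, he⟩ := exists_sqrt_density hh
  -- With s = d^{1/2} and t = s⁻¹, the trace of (s − t)² is tr(d) + tr(d⁻¹) − 2 tr(1) = 0, so s = t.
  have h1 : star (s - t) * (s - t) = density h (regularTrace A) - 1 +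
      (Ring.inverse (density h (regularTrace A)) - 1) := by
    rw [star_sub, hs, ht, he, hd, sub_mul, mul_sub, mul_sub, hst, hts]
    abel
  have h2 : s - t = 0 := by
    apply eq_zero_of_regularTrace_star_mul_self
    rw [h1, map_add, map_sub, map_sub, htr, (isTraceFrame hh).trace_density regularTrace_apply]
    simp
  rw [sub_eq_zero] at h2
  rw [hd]
  conv_lhs => rw [h2]
  rw [← h2] at hts ⊢
  exact hts

end CStarWeakHopfAlgebra

end

/-! ### The equivalence -/

open WeakHopfAlgebra CStarWeakHopfAlgebra in
theorem mainTheorem12 (A : Type*) [CStarAlgebra A] [PartialOrder A] [StarOrderedRing A]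
    [FiniteDimensional ℂ A] [CStarWeakHopfAlgebra A] :
    (∃! h : A, WeakHopfAlgebra.IsHaarIntegral ℂ h) ∧
    (∃! η : Module.Dual ℂ A, WeakHopfAlgebra.IsHaarFunctional η) ∧
    ∀ (h : A) (η : Module.Dual ℂ A),
      WeakHopfAlgebra.IsHaarIntegral ℂ h → WeakHopfAlgebra.IsHaarFunctional η →
      IsStrictlyPositive (WeakHopfAlgebra.hitRight h η) ∧
      List.TFAE [
        ∀ x : A, WeakHopfAlgebra.antipode (k := ℂ) (WeakHopfAlgebra.antipode (k := ℂ) x) = x,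
        ∀ x y : A, η (x * y) = η (y * x),
        Coalgebra.counit (R := ℂ) (Ring.inverse (grouplikeR h η) ^ 2) =
          (Module.finrank ℂ A : ℂ)] := by
  obtain ⟨h₀, hh₀, -⟩ := exists_haarIntegral A
  obtain ⟨z₀, D₀⟩ := exists_isCounitDensity hh₀
  refine ⟨⟨h₀, hh₀, fun h hh => hh.eq hh₀⟩,
    ⟨_, D₀.isHaarFunctional, fun η hη => hη.eq D₀.isHaarFunctional⟩, fun h η hh hη => ?_⟩
  obtain ⟨z, D⟩ := exists_isCounitDensity hh
  obtain rfl := hη.eq D.isHaarFunctional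
  have hz := isStrictlyPositive_counitDensity D
  have hg : Ring.inverse (grouplikeR h (haarFunctional h (regularTrace A) z)) ^ 2 =
      Ring.inverse z := by
    rw [grouplikeR, D.hitRight_eq, Ring.inverse_pow, CFC.sq_sqrt z hz.nonneg]
  rw [D.hitRight_eq, hg, counit_inverse D, ← regularTrace_one]
  refine ⟨hz, ?_⟩
  have hd (hS : ∀ x : A, anti ℂ A (anti ℂ A x) = x) : density h (regularTrace A) = 1 := by
    rw [D.density_eq_mul'_comm regularTrace_apply, D.mul'_comm_casimir_of_anti_anti hS]
  tfae_have 1 → 2 := fun hS => D.trace_of_anti_anti hS (hd hS)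
  tfae_have 2 → 1 := fun ht => D.anti_anti_of_trace hz.isUnit ht
  tfae_have 1 → 3 := fun hS => by rw [hd hS, Ring.inverse_one]
  tfae_have 3 → 1 := fun htr x => by
    have := D.mul_density' x
    rw [density_eq_one hh htr, mul_one, one_mul] at this
    exact this.symm
  tfae_finish
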